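/- Let $M$ be a smooth manifold, $g$ a smooth Riemannian metric on $M$ with Levi-Civita connection $\hat\nabla$, and $\nabla$ a smooth torsion-free affine connection on $M$ such that $(g,\nabla)$ is a statistical structure, that is, the cubic form $\nabla g$ is symmetric. Write $R,\hat R$ for the curvature tensors of $\nabla,\hat\nabla$, with $R(X,Y)Z=\nabla_X\nabla_YZ-\nabla_Y\nabla_XZ-\nabla_{[X,Y]}Z$, and $\mathrm{Ric},\widehat{\mathrm{Ric}}$ for their Ricci tensors, with $\mathrm{Ric}(Y,Z)=\mathrm{tr}\{X\mapsto R(X,Y)Z\}$. Assume that the structure is conjugate symmetric, that is, $g(R(X,Y)Z,W)=-g(R(X,Y)W,Z)$ for all $X,Y,Z,W$. Put $$K(X,Y)=K_XY=\nabla_XY-\hat\nabla_XY,\quad A(X,Y,Z)=g(K(X,Y),Z),\quad \tau(X)=\mathrm{tr}_g A(X,\cdot,\cdot),$$ $$[K,K](X,Y)Z=K_XK_YZ-K_YK_XZ,\quad (\tau\circ K)(X,Y)=\tau(K(X,Y)),\quad g(K_\cdot,K_\cdot)(X,Y)=g(K_X,K_Y),$$ where $g$ also denotes the induced scalar product of tensors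 of the same type (so that $g(K_X,K_Y)=\sum_i g(K_Xe_i,K_Ye_i)$, and for curvature-type tensors $g(S,T)=\sum_{i,j,k} g(S(e_i,e_j)e_k,T(e_i,e_j)e_k)$, for any orthonormal basis $(e_i)$), $\|T\|^2=g(T,T)$, $\hat\nabla^2=\hat\nabla\hat\nabla$, and $\Delta f=\mathrm{tr}_g\hat\nabla^2 f$ for functions $f$. Then, on all of $M$, $$\tfrac12\Delta(\|A\|^2)=\|\hat\nabla A\|^2+g(\hat\nabla^2\tau,A)-g([K,K],\hat R)+g(\widehat{\mathrm{Ric}},g(K_\cdot,K_\cdot)),$$ $$\tfrac12\Delta(\|A\|^2)=\|\hat\nabla A\|^2+g(\hat\nabla^2\tau,A)+g(\hat R-R,\hat R)+g(\widehat{\mathrm{Ric}},g(K_\cdot,K_\cdot)),$$ $$\tfrac12\Delta(\|A\|^2)=\|\hat\nabla A\|^2+g(\hat\nabla^2\tau,A)+\|\hat R\|^2+\|\widehat{\mathrm{Ric}}\|^2-g(R,\hat R)-g(\mathrm{Ric},\widehat{\mathrm{Ric}})+g(\widehat{\mathrm{Ric}},\tau\circ K).$$ -/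

import Mathlib

open scoped Manifold ContDiff

noncomputable section

open Bundle FiberBundle VectorField

namespace StatGeom

variable {E : Type*} [NormedAddCommGroup E] [NormedSpace ℝ E]
  {H : Type*} [TopologicalSpace H] {I : ModelWithCorners ℝ E H}
  {M : Type*} [TopologicalSpace M] [ChartedSpace H M] [IsManifold I ∞ M]

variable (I M) in
/-- Smooth Riemannian metrics on `M`. -/
abbrev SmoothMetric : Type _ := ContMDiffRiemannianMetric I ∞ E (fun x : M ↦ TangentSpace I x)

variable (I M) in
/-- Affine connections on `M`; `D Y x (X x)` is `(∇_X Y)(x)`. -/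
abbrev Connection : Type _ := CovariantDerivative I E (fun x : M ↦ TangentSpace I x)

lemma mdifferentiableAt_metric (g : SmoothMetric I M) {x : M} {X Y : Π x : M, TangentSpace I x}
    (hX : MDiffAt (T% X) x) (hY : MDiffAt (T% Y) x) :
    MDiffAt (fun y ↦ g.inner y (X y) (Y y)) x := by
  have : MDifferentiableAt I (I.prod 𝓘(ℝ)) 
      (fun m ↦ TotalSpace.mk' ℝ (E := Bundle.Trivial M ℝ) m (g.inner m (X m) (Y m))) x := by
    apply MDifferentiableAt.clm_bundle_apply₂ (F₁ := E) (F₂ := E)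
    · exact g.contMDiff.mdifferentiableAt (by simp)
    · exact hX
    · exact hY
  simp only [mdifferentiableAt_totalSpace] at this
  exact this.2

variable [FiniteDimensional ℝ E]

/-- Every tangent space has a `g`-orthonormal basis. -/
lemma exists_orthonormalBasis (g : SmoothMetric I M) (x : M) :
    ∃ e : Module.Basis (Fin (Module.finrank ℝ E)) ℝ (TangentSpace I x),
      ∀ i j, g.inner x (e i) (e j) = if i = j then 1 else 0 := by
  let _ : RiemannianBundle (fun x : M ↦ TangentSpace I x) := ⟨g.toRiemannianMetric⟩
  have _ : FiniteDimensional ℝ (TangentSpace I x) := ‹FiniteDimensional ℝ E›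
  let b := (stdOrthonormalBasis ℝ (TangentSpace I x)).reindex
    (finCongr (show Module.finrank ℝ (TangentSpace I x) = Module.finrank ℝ E from rfl))
  exact ⟨b.toBasis, fun i j ↦ by
    have h := orthonormal_iff_ite.mp b.orthonormal i j
    simp only [OrthonormalBasis.coe_toBasis]
    exact h⟩

/-- An orthonormal basis of the Euclidean space `(T_x M, g_x)`. -/
def onb (g : SmoothMetric I M) (x : M) :
    Module.Basis (Fin (Module.finrank ℝ E)) ℝ (TangentSpace I x) :=
  (exists_orthonormalBasis g x).choose

lemma onb_spec (g : SmoothMetric I M) (x : M) (i j : Fin (Module.finrank ℝ E)) :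
    g.inner x (onb g x i) (onb g x j) = if i = j then 1 else 0 :=
  (exists_orthonormalBasis g x).choose_spec i j

/-- The right-hand side at `x` of the Koszul formula for `2 g(∇̂_X Y, Z)`. -/
def koszul (g : SmoothMetric I M) (X Y Z : Π x : M, TangentSpace I x) (x : M) : ℝ :=
  mvfderiv I (fun y ↦ g.inner y (Y y) (Z y)) x (X x)
    + mvfderiv I (fun y ↦ g.inner y (X y) (Z y)) x (Y x)
    - mvfderiv I (fun y ↦ g.inner y (X y) (Y y)) x (Z x)
    + g.inner x (mlieBracket I X Y x) (Z x)
    - g.inner x (mlieBracket I X Z x) (Y x)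
    - g.inner x (mlieBracket I Y Z x) (X x)

lemma tensorialAt_koszul_left (g : SmoothMetric I M) {x : M} {Y Z : Π x : M, TangentSpace I x}
    (hY : MDiffAt (T% Y) x) (hZ : MDiffAt (T% Z) x) :
    TensorialAt I E (fun X ↦ koszul g X Y Z x) x where
  smul {f X} hf hX := by
    have h1 : (fun y ↦ g.inner y ((f • X) y) (Z y)) = fun y ↦ f y * g.inner y (X y) (Z y) := by
      ext y; simp
    have h2 : (fun y ↦ g.inner y ((f • X) y) (Y y)) = fun y ↦ f y * g.inner y (X y) (Y y) := by
      ext y; simp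
    simp only [koszul]
    rw [h1, h2, mvfderiv_fun_mul hf (mdifferentiableAt_metric g hX hZ),
      mvfderiv_fun_mul hf (mdifferentiableAt_metric g hX hY),
      mlieBracket_smul_left hf hX, mlieBracket_smul_left hf hX]
    simp
    ring
  add {X X'} hX hX' := by
    have h1 : (fun y ↦ g.inner y ((X + X') y) (Z y)) = fun y ↦ g.inner y (X y) (Z y) +
        g.inner y (X' y) (Z y) := by
      ext y; simp
    have h2 : (fun y ↦ g.inner y ((X + X') y) (Y y)) = fun y ↦ g.inner y (X y) (Y y) +
        g.inner y (X' y) (Y y) := by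
      ext y; simp
    simp only [koszul]
    rw [h1, h2, mvfderiv_fun_add (mdifferentiableAt_metric g hX hZ)
      (mdifferentiableAt_metric g hX' hZ), mvfderiv_fun_add (mdifferentiableAt_metric g hX hY)
      (mdifferentiableAt_metric g hX' hY), mlieBracket_add_left hX hX', mlieBracket_add_left hX hX']
    simp
    ring

lemma tensorialAt_koszul_right (g : SmoothMetric I M) {x : M} {X Y : Π x : M, TangentSpace I x}
    (hX : MDiffAt (T% X) x) (hY : MDiffAt (T% Y) x) :
    TensorialAt I E (fun Z ↦ koszul g X Y Z x) x where
  smul {f Z} hf hZ := by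
    have h1 : (fun y ↦ g.inner y (X y) ((f • Z) y)) = fun y ↦ f y * g.inner y (X y) (Z y) := by
      ext y; simp
    have h2 : (fun y ↦ g.inner y (Y y) ((f • Z) y)) = fun y ↦ f y * g.inner y (Y y) (Z y) := by
      ext y; simp
    simp only [koszul]
    rw [h1, h2, mvfderiv_fun_mul hf (mdifferentiableAt_metric g hX hZ),
      mvfderiv_fun_mul hf (mdifferentiableAt_metric g hY hZ),
      mlieBracket_smul_right hf hZ, mlieBracket_smul_right hf hZ]
    simp [g.symm x (Z x) (X x), g.symm x (Z x) (Y x)]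
    ring
  add {Z Z'} hZ hZ' := by
    have h1 : (fun y ↦ g.inner y (X y) ((Z + Z') y)) = fun y ↦ g.inner y (X y) (Z y) +
        g.inner y (X y) (Z' y) := by
      ext y; simp
    have h2 : (fun y ↦ g.inner y (Y y) ((Z + Z') y)) = fun y ↦ g.inner y (Y y) (Z y) +
        g.inner y (Y y) (Z' y) := by
      ext y; simp
    simp only [koszul]
    rw [h1, h2, mvfderiv_fun_add (mdifferentiableAt_metric g hX hZ)
      (mdifferentiableAt_metric g hX hZ'), mvfderiv_fun_add (mdifferentiableAt_metric g hY hZ)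
      (mdifferentiableAt_metric g hY hZ'), mlieBracket_add_right hZ hZ',
      mlieBracket_add_right hZ hZ']
    simp
    ring

lemma koszul_add_middle (g : SmoothMetric I M) {x : M} {X Y Y' Z : Π x : M, TangentSpace I x}
    (hX : MDiffAt (T% X) x) (hY : MDiffAt (T% Y) x) (hY' : MDiffAt (T% Y') x)
    (hZ : MDiffAt (T% Z) x) :
    koszul g X (Y + Y') Z x = koszul g X Y Z x + koszul g X Y' Z x := by
  have h1 : (fun y ↦ g.inner y ((Y + Y') y) (Z y)) = fun y ↦ g.inner y (Y y) (Z y) +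
      g.inner y (Y' y) (Z y) := by
    ext y; simp
  have h2 : (fun y ↦ g.inner y (X y) ((Y + Y') y)) = fun y ↦ g.inner y (X y) (Y y) +
      g.inner y (X y) (Y' y) := by
    ext y; simp
  simp only [koszul]
  rw [h1, h2, mvfderiv_fun_add (mdifferentiableAt_metric g hY hZ)
    (mdifferentiableAt_metric g hY' hZ), mvfderiv_fun_add (mdifferentiableAt_metric g hX hY)
    (mdifferentiableAt_metric g hX hY'), mlieBracket_add_right hY hY', mlieBracket_add_left hY hY']
  simp
  ring

lemma koszul_smul_middle (g : SmoothMetric I M) {x : M} {f : M → ℝ}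
    {X Y Z : Π x : M, TangentSpace I x} (hf : MDiffAt f x)
    (hX : MDiffAt (T% X) x) (hY : MDiffAt (T% Y) x) (hZ : MDiffAt (T% Z) x) :
    koszul g X (f • Y) Z x
      = f x * koszul g X Y Z x + 2 * (mvfderiv I f x (X x) * g.inner x (Y x) (Z x)) := by
  have h1 : (fun y ↦ g.inner y ((f • Y) y) (Z y)) = fun y ↦ f y * g.inner y (Y y) (Z y) := by
    ext y; simp
  have h2 : (fun y ↦ g.inner y (X y) ((f • Y) y)) = fun y ↦ f y * g.inner y (X y) (Y y) := by
    ext y; simp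
  simp only [koszul]
  rw [h1, h2, mvfderiv_fun_mul hf (mdifferentiableAt_metric g hY hZ),
    mvfderiv_fun_mul hf (mdifferentiableAt_metric g hX hY),
    mlieBracket_smul_right hf hY, mlieBracket_smul_left hf hY]
  simp [g.symm x (Y x) (X x)]
  ring

lemma sum_onb (g : SmoothMetric I M) (x : M) (v : TangentSpace I x) :
    ∑ i, g.inner x v (onb g x i) • onb g x i = v := by
  conv_rhs => rw [← (onb g x).sum_repr v]
  refine Finset.sum_congr rfl fun i _ ↦ ?_
  congr 1
  have h := congrArg (fun w ↦ g.inner x w (onb g x i)) ((onb g x).sum_repr v)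
  simp only [map_sum, map_smul, _root_.sum_apply, _root_.smul_apply, onb_spec, smul_eq_mul,
    mul_ite, mul_one, mul_zero, Finset.sum_ite_eq', Finset.mem_univ, if_true] at h
  exact h.symm

open scoped Classical in
/-- The Levi-Civita connection of `g`. At a point where `Y` is differentiable, `∇̂_X Y` is the vector
whose inner product with every `Z` is half of the Koszul expression. -/
def leviCivita (g : SmoothMetric I M) : Connection I M where
  toFun Y x :=
    if hY : MDiffAt (T% Y) x then
      ∑ i, ((1 / 2 : ℝ) • TensorialAt.mkHom (fun X ↦ koszul g X Y (extend E (onb g x i)) x) x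
        (tensorialAt_koszul_left g hY (mdifferentiableAt_extend ..))).smulRight (onb g x i)
    else 0
  isCovariantDerivativeOnUniv :=
    { add := by
        intro Y Y' x hY hY' _
        have hYY' : MDiffAt (T% (Y + Y')) x := mdifferentiableAt_add_section hY hY'
        rw [dif_pos hY, dif_pos hY', dif_pos hYY', ← Finset.sum_add_distrib]
        refine Finset.sum_congr rfl fun i _ ↦ ?_
        ext v
        simp only [ContinuousLinearMap.smulRight_apply, _root_.add_apply, ← add_smul,
          _root_.smul_apply, TensorialAt.mkHom_apply_eq_extend, smul_eq_mul]
        congr 1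
        have hX : MDiffAt (T% (extend E v)) x := mdifferentiableAt_extend ..
        have hZ : MDiffAt (T% (extend E (onb g x i))) x := mdifferentiableAt_extend ..
        rw [koszul_add_middle g hX hY hY' hZ]
        ring
      leibniz := by
        intro Y f x hY hf _
        have hfY : MDiffAt (T% (f • Y)) x := hf.smul_section hY
        rw [dif_pos hY, dif_pos hfY]
        ext v
        have hX : MDiffAt (T% (extend E v)) x := mdifferentiableAt_extend ..
        have hZ (i) : MDiffAt (T% (extend E (onb g x i))) x := mdifferentiableAt_extend ..
        simp only [ContinuousLinearMap.smulRight_apply, _root_.add_apply,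
          _root_.smul_apply, TensorialAt.mkHom_apply_eq_extend, smul_eq_mul,
          _root_.sum_apply, koszul_smul_middle g hf hX hY (hZ _), extend_apply_self]
        conv_rhs => rw [← sum_onb g x (Y x)]
        rw [Finset.smul_sum, Finset.smul_sum, ← Finset.sum_add_distrib]
        refine Finset.sum_congr rfl fun i _ ↦ ?_
        rw [smul_smul, smul_smul, ← add_smul]
        congr 1
        ring }

/-- The Koszul formula. -/
theorem koszul_formula (g : SmoothMetric I M) {x : M} {X Y Z : Π x : M, TangentSpace I x}
    (hX : MDiffAt (T% X) x) (hY : MDiffAt (T% Y) x) (hZ : MDiffAt (T% Z) x) :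
    2 * g.inner x (leviCivita g Y x (X x)) (Z x) = koszul g X Y Z x := by
  have hr := tensorialAt_koszul_right g hX hY
  have h : leviCivita g Y x (X x) =
      ∑ i, ((1 / 2 : ℝ) * koszul g X Y (extend E (onb g x i)) x) • onb g x i := by
    simp only [leviCivita, dif_pos hY, _root_.sum_apply,
      ContinuousLinearMap.smulRight_apply, _root_.smul_apply, smul_eq_mul]
    refine Finset.sum_congr rfl fun i _ ↦ ?_
    rw [TensorialAt.mkHom_apply _ hX]
  rw [← TensorialAt.mkHom_apply hr hZ, h]
  conv_rhs => rw [← sum_onb g x (Z x)]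
  simp only [map_sum, map_smul, _root_.sum_apply, _root_.smul_apply, smul_eq_mul,
    TensorialAt.mkHom_apply_eq_extend, Finset.mul_sum]
  refine Finset.sum_congr rfl fun i _ ↦ ?_
  rw [g.symm x (Z x)]
  ring

/-- `∇̂` is torsion-free. -/
theorem leviCivita_torsion (g : SmoothMetric I M) : (leviCivita g).torsion = 0 := by
  rw [CovariantDerivative.torsion_eq_zero_iff]
  intro X Y x hX hY
  set w := leviCivita g Y x (X x) - leviCivita g X x (Y x) - mlieBracket I X Y x with hw
  have hw0 : ∀ i, g.inner x w (onb g x i) = 0 := by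
    intro i
    have hZ : MDiffAt (T% (extend E (onb g x i))) x := mdifferentiableAt_extend ..
    have h1 := koszul_formula g hX hY hZ
    have h2 := koszul_formula g hY hX hZ
    have h3 : (fun y ↦ g.inner y (X y) (Y y)) = fun y ↦ g.inner y (Y y) (X y) := by
      ext y; exact g.symm y _ _
    simp only [koszul, extend_apply_self, mlieBracket_swap_apply (V := Y) (W := X), h3] at h1 h2
    simp only [hw, map_sub, _root_.sub_apply]
    simp only [map_neg, _root_.neg_apply] at h2
    linarith
  have : w = 0 := by
    rw [← sum_onb g x w]
    simp [hw0]
  exact sub_eq_zero.mp this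

/-- `∇̂` is compatible with `g`. -/
theorem leviCivita_metric (g : SmoothMetric I M) {x : M} {X Y Z : Π x : M, TangentSpace I x}
    (hX : MDiffAt (T% X) x) (hY : MDiffAt (T% Y) x) (hZ : MDiffAt (T% Z) x) :
    mvfderiv I (fun y ↦ g.inner y (Y y) (Z y)) x (X x)
      = g.inner x (leviCivita g Y x (X x)) (Z x) + g.inner x (Y x) (leviCivita g Z x (X x)) := by
  have h1 := koszul_formula g hX hY hZ
  have h2 := koszul_formula g hX hZ hY
  have h3 : (fun y ↦ g.inner y (Z y) (Y y)) = fun y ↦ g.inner y (Y y) (Z y) := by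
    ext y; exact g.symm y _ _
  simp only [koszul, mlieBracket_swap_apply (V := Z) (W := Y), h3, map_neg,
    _root_.neg_apply] at h1 h2
  rw [g.symm x (Y x)]
  linarith

/-! ### Tensor fields and their covariant derivatives -/

variable (I M) in
/-- A tensor field of type `(0, k)`, as an operation on `k` vector fields; all the tensor fields below
are tensorial (linear over smooth functions) on smooth vector fields. -/
abbrev TensorField (k : ℕ) : Type _ := (Fin k → Π x : M, TangentSpace I x) → M → ℝ

/-- The value of a tensor field at `x` on tangent vectors: apply it to vector fields, smooth near
`x`, that extend these vectors. The value does not depend on the extension if `T` is tensorial. -/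
def TensorField.val {k : ℕ} (T : TensorField I M k) (x : M) (v : Fin k → TangentSpace I x) : ℝ :=
  T (fun a ↦ extend E (v a)) x

/-- The covariant derivative `∇T` of a tensor field of type `(0, k)`:
`(∇T)(X₀, X₁, …, X_k) = X₀ (T(X₁, …, X_k)) - ∑ₐ T(X₁, …, ∇_{X₀} Xₐ, …, X_k)`. -/
def covDeriv (D : Connection I M) {k : ℕ} (T : TensorField I M k) : TensorField I M (k + 1) :=
  fun X x ↦ mvfderiv I (T (Fin.tail X)) x (X 0 x)
    - ∑ a : Fin k, T (Function.update (Fin.tail X) a (fun y ↦ D (Fin.tail X a) y (X 0 y))) x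

/-- `T` is a symmetric tensor field. -/
def IsSymmetric {k : ℕ} (T : TensorField I M k) : Prop :=
  ∀ (x : M) (v : Fin k → TangentSpace I x) (σ : Equiv.Perm (Fin k)), T.val x (v ∘ σ) = T.val x v

/-- The scalar product `g(S, T)` of two tensor fields of the same type. -/
def tensorInner (g : SmoothMetric I M) {k : ℕ} (S T : TensorField I M k) (x : M) : ℝ :=
  ∑ i : Fin k → Fin (Module.finrank ℝ E),
    S.val x (fun a ↦ onb g x (i a)) * T.val x (fun a ↦ onb g x (i a))

/-- `‖T‖²`. -/
def tensorNormSq (g : SmoothMetric I M) {k : ℕ} (T : TensorField I M k) (x : M) : ℝ :=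
  tensorInner g T T x

/-- The Laplacian `(Δs)(X₁, …, X_k) = ∑ᵢ (∇̂²s)(eᵢ, eᵢ, X₁, …, X_k)`. -/
def laplacian (g : SmoothMetric I M) {k : ℕ} (s : TensorField I M k) : TensorField I M k :=
  fun X x ↦ ∑ i, covDeriv (leviCivita g) (covDeriv (leviCivita g) s)
    (Fin.cons (extend E (onb g x i)) (Fin.cons (extend E (onb g x i)) X)) x

/-- The Laplacian of a function. -/
def laplacianFun (g : SmoothMetric I M) (f : M → ℝ) (x : M) : ℝ :=
  laplacian (I := I) (k := 0) g (fun _ ↦ f) Fin.elim0 x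

/-- The metric as a tensor field. -/
def metricTensor (g : SmoothMetric I M) : TensorField I M 2 :=
  fun X x ↦ g.inner x (X 0 x) (X 1 x)

/-! ### Curvature -/

/-- `R(X, Y)Z = ∇_X ∇_Y Z - ∇_Y ∇_X Z - ∇_{[X, Y]} Z`. -/
def curvature (D : Connection I M) (X Y Z : Π x : M, TangentSpace I x) :
    Π x : M, TangentSpace I x :=
  fun x ↦ D (fun y ↦ D Z y (Y y)) x (X x) - D (fun y ↦ D Z y (X y)) x (Y x)
    - D Z x (mlieBracket I X Y x)

/-- For an operation `C` of type `(1, 3)`, the tensor field `g(C(X, Y)Z, W)` of type `(0, 4)`. -/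
def lower (g : SmoothMetric I M)
    (C : (X Y Z : Π x : M, TangentSpace I x) → Π x : M, TangentSpace I x) : TensorField I M 4 :=
  fun X x ↦ g.inner x (C (X 0) (X 1) (X 2) x) (X 3 x)

/-- The curvature tensor of `D` as the tensor field `g(R(X, Y)Z, W)` of type `(0, 4)`. -/
def riem (g : SmoothMetric I M) (D : Connection I M) : TensorField I M 4 :=
  lower g (curvature D)

/-- The Ricci tensor `Ric(Y, Z) = tr {X ↦ R(X, Y)Z}`, the trace being computed in a
`g`-orthonormal basis. -/
def ricci (g : SmoothMetric I M) (D : Connection I M) : TensorField I M 2 :=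
  fun X x ↦ ∑ i, g.inner x (curvature D (extend E (onb g x i)) (X 0) (X 1) x) (onb g x i)

/-! ### Statistical structures -/

/-- `(g, ∇)` is a statistical structure: `∇` is a smooth torsion-free connection and the cubic form
`∇g` is symmetric. -/
structure IsStatistical (g : SmoothMetric I M) (D : Connection I M) : Prop where
  smooth : D.ContMDiffCovariantDerivative ∞
  torsion_free : D.torsion = 0
  symmetric : IsSymmetric (covDeriv D (metricTensor g))

/-- A statistical structure is conjugate symmetric if `g(R(X, Y)Z, W) = -g(R(X, Y)W, Z)`. -/
def IsConjugateSymmetric (g : SmoothMetric I M) (D : Connection I M) : Prop :=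
  ∀ (x : M) (X Y Z W : TangentSpace I x),
    (riem g D).val x ![X, Y, Z, W] = -(riem g D).val x ![X, Y, W, Z]

/-- The difference tensor `K(X, Y) = K_X Y = ∇_X Y - ∇̂_X Y`. -/
def diffTensor (g : SmoothMetric I M) (D : Connection I M) (X Y : Π x : M, TangentSpace I x) :
    Π x : M, TangentSpace I x :=
  fun x ↦ D Y x (X x) - leviCivita g Y x (X x)

/-- The cubic form `A(X, Y, Z) = g(K(X, Y), Z)`. -/
def cubicForm (g : SmoothMetric I M) (D : Connection I M) : TensorField I M 3 :=
  fun X x ↦ g.inner x (diffTensor g D (X 0) (X 1) x) (X 2 x)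

/-- The Czebyshev form `τ(X) = tr_g A(X, ·, ·)`. -/
def czebyshev (g : SmoothMetric I M) (D : Connection I M) : TensorField I M 1 :=
  fun X x ↦ ∑ i, cubicForm g D ![X 0, extend E (onb g x i), extend E (onb g x i)] x

/-- `(τ ∘ K)(X, Y) = τ(K(X, Y))`. -/
def czebyshevDiff (g : SmoothMetric I M) (D : Connection I M) : TensorField I M 2 :=
  fun X x ↦ czebyshev g D ![diffTensor g D (X 0) (X 1)] x

/-- `[K, K](X, Y)Z = [K_X, K_Y]Z = K_X K_Y Z - K_Y K_X Z`. -/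
def bracketKK (g : SmoothMetric I M) (D : Connection I M)
    (X Y Z : Π x : M, TangentSpace I x) : Π x : M, TangentSpace I x :=
  diffTensor g D X (diffTensor g D Y Z) - diffTensor g D Y (diffTensor g D X Z)

/-- `g(K_·, K_·)(X, Y) = g(K_X, K_Y)`, the scalar product of the endomorphisms `K_X` and `K_Y`. -/
def innerKK (g : SmoothMetric I M) (D : Connection I M) : TensorField I M 2 :=
  fun X x ↦ ∑ i, g.inner x (diffTensor g D (X 0) (extend E (onb g x i)) x)
    (diffTensor g D (X 1) (extend E (onb g x i)) x)

end StatGeom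

end

open StatGeom

open scoped Manifold ContDiff
noncomputable section

open Bundle FiberBundle VectorField Filter Topology

namespace StatGeom

variable {E : Type*} [NormedAddCommGroup E] [NormedSpace ℝ E]
  {H : Type*} [TopologicalSpace H] {I : ModelWithCorners ℝ E H}
  {M : Type*} [TopologicalSpace M] [ChartedSpace H M]

/-! ### Vector fields and functions that are smooth near a point -/

/-! The starting point is the Bochner formula ½ Δ‖A‖² = ‖∇̂A‖² + g(ΔA, A)
(`laplacianFun_tensorNormSq`), so everything rests on computing the rough Laplacian ΔA.

Write ∇ = ∇̂ + K. Then R = R̂ + (the antisymmetrization of ∇̂K in its first two arguments) + [K, K].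
For a statistical structure A is totally symmetric, so each K_X is self-adjoint, and g([K, K](X,
Y)Z, W) is skew in Z, W, as is R̂. The middle term is symmetric in Z, W. Conjugate symmetry
therefore kills it: ∇̂A is totally symmetric (`codazzi`), and R = R̂ + [K, K] (`gauss_equation`).

In (∇̂²A)(e, e, X, Y, Z), total symmetry of ∇̂A lets the second e change places with X, the Ricci
identity exchanges the two derivatives at the cost of curvature terms, and symmetry again moves both
e's to the end, where their trace is ∇̂²τ (`laplacian_cubicForm`). Contracted with A, the curvature
terms become -g([K, K], R̂) + g(Ric^, g(K, K)) (`sum_curvature_mul_cubic`). This is the first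
formula; the other two follow from the Gauss equation and its trace `ricci_eq`.

The analytic groundwork is needed because tensor fields are bare operations on vector fields,
evaluated on extensions that are smooth only near the point, and because scalar products use an
orthonormal basis chosen separately at each point. Hence smoothness is required only near a point,
tensoriality is recorded in `IsTensorOn`, and derivatives of contractions are computed in smooth
orthonormal frames. -/

variable (I) in
/-- The function `f` is smooth near `x`. -/
def SmoothFunNear (f : M → ℝ) (x : M) : Prop :=
  ∀ᶠ y in 𝓝 x, CMDiffAt ∞ f y

section

variable {f f' : M → ℝ} {x : M}

lemma SmoothFunNear.self (h : SmoothFunNear I f x) : CMDiffAt ∞ f x := h.self_of_nhds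

lemma SmoothFunNear.mdiff (h : SmoothFunNear I f x) : MDiffAt f x :=
  h.self.mdifferentiableAt (by simp)

lemma SmoothFunNear.eventually (h : SmoothFunNear I f x) : ∀ᶠ y in 𝓝 x, SmoothFunNear I f y :=
  eventually_eventually_nhds.mpr h

lemma SmoothFunNear.congr (h : SmoothFunNear I f x) (hf : ∀ᶠ y in 𝓝 x, f' y = f y) :
    SmoothFunNear I f' x := by
  filter_upwards [h, eventually_eventually_nhds.mpr hf] with y hy hy'
  exact hy.congr_of_eventuallyEq hy'

lemma smoothFunNear_const (c : ℝ) : SmoothFunNear I (fun _ : M ↦ c) x :=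
  .of_forall fun _ ↦ contMDiffAt_const

lemma SmoothFunNear.add (h : SmoothFunNear I f x) (h' : SmoothFunNear I f' x) :
    SmoothFunNear I (fun y ↦ f y + f' y) x := by
  filter_upwards [h, h'] with y hy hy' using ContMDiffAt.add hy hy'

lemma SmoothFunNear.sub (h : SmoothFunNear I f x) (h' : SmoothFunNear I f' x) :
    SmoothFunNear I (fun y ↦ f y - f' y) x := by
  filter_upwards [h, h'] with y hy hy' using ContMDiffAt.sub hy hy'

lemma SmoothFunNear.mul (h : SmoothFunNear I f x) (h' : SmoothFunNear I f' x) :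
    SmoothFunNear I (fun y ↦ f y * f' y) x := by
  filter_upwards [h, h'] with y hy hy' using ContMDiffAt.mul hy hy'

lemma SmoothFunNear.sum {ι : Type*} {s : Finset ι} {f : ι → M → ℝ}
    (h : ∀ i ∈ s, SmoothFunNear I (f i) x) : SmoothFunNear I (fun y ↦ ∑ i ∈ s, f i y) x := by
  have := (Filter.eventually_all_finset s).mpr h
  filter_upwards [this] with y hy
  exact ContMDiffAt.sum hy

/-- Composition with a function that is smooth away from zero. -/
lemma SmoothFunNear.comp_of_ne {φ : ℝ → ℝ} (hφ : ∀ t ≠ 0, ContDiffAt ℝ ∞ φ t)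
    (h : SmoothFunNear I f x) (h0 : f x ≠ 0) : SmoothFunNear I (fun y ↦ φ (f y)) x := by
  have h1 : ∀ᶠ y in 𝓝 x, f y ≠ 0 := h.self.continuousAt.eventually_ne h0
  filter_upwards [h, h1] with y hy hy'
  exact ContMDiffAt.comp (I' := 𝓘(ℝ, ℝ)) y (hφ _ hy').contMDiffAt hy

end

variable [IsManifold I ∞ M]

/-- The vector field `X` is smooth near `x`. -/
def SmoothNear (X : Π x : M, TangentSpace I x) (x : M) : Prop :=
  ∀ᶠ y in 𝓝 x, CMDiffAt ∞ (T% X) y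

variable {X Y Z : Π x : M, TangentSpace I x} {f : M → ℝ} {x : M}

lemma SmoothNear.self (h : SmoothNear X x) : CMDiffAt ∞ (T% X) x := h.self_of_nhds

lemma SmoothNear.mdiff (h : SmoothNear X x) : MDiffAt (T% X) x :=
  h.self.mdifferentiableAt (by simp)

lemma SmoothNear.eventually (h : SmoothNear X x) : ∀ᶠ y in 𝓝 x, SmoothNear X y :=
  eventually_eventually_nhds.mpr h

lemma SmoothNear.congr (h : SmoothNear X x) (hf : ∀ᶠ y in 𝓝 x, Y y = X y) :
    SmoothNear Y x := by
  filter_upwards [h, eventually_eventually_nhds.mpr hf] with y hy hy'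
  refine hy.congr_of_eventuallyEq ?_
  filter_upwards [hy'] with z hz
  rw [hz]

lemma SmoothNear.add (h : SmoothNear X x) (h' : SmoothNear Y x) : SmoothNear (X + Y) x := by
  filter_upwards [h, h'] with y hy hy' using hy.add_section hy'

lemma SmoothNear.sub (h : SmoothNear X x) (h' : SmoothNear Y x) : SmoothNear (X - Y) x := by
  filter_upwards [h, h'] with y hy hy' using hy.sub_section hy'

lemma SmoothNear.smul (hf : SmoothFunNear I f x) (h : SmoothNear X x) : SmoothNear (f • X) x := by
  filter_upwards [hf, h] with y hy hy' using hy.smul_section hy'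

lemma SmoothNear.sum {ι : Type*} {s : Finset ι} {X : ι → Π x : M, TangentSpace I x}
    (h : ∀ i ∈ s, SmoothNear (X i) x) : SmoothNear (fun y ↦ ∑ i ∈ s, X i y) x := by
  have := (Filter.eventually_all_finset s).mpr h
  filter_upwards [this] with y hy
  exact ContMDiffAt.sum_section hy

lemma smoothNear_zero : SmoothNear (fun y : M ↦ (0 : TangentSpace I y)) x := by
  simpa using SmoothNear.sum (s := (∅ : Finset ℕ)) (X := fun _ y ↦ (0 : TangentSpace I y)) (by simp)

/-- The extensions used by `TensorField.val` qualify as arguments for all the tensoriality lemmas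
below. -/
lemma smoothNear_extend (v : TangentSpace I x) : SmoothNear (extend E v) x := by
  obtain ⟨s, hs, h⟩ := exists_contMDiffOn_extend (k := ∞) I E v
  filter_upwards [eventually_mem_nhds_iff.mpr hs] with y hy
  exact h.contMDiffAt hy

lemma SmoothNear.metric (g : SmoothMetric I M) (h : SmoothNear X x) (h' : SmoothNear Y x) :
    SmoothFunNear I (fun y ↦ g.inner y (X y) (Y y)) x := by
  filter_upwards [h, h'] with y hy hy'
  have : ContMDiffAt I (I.prod 𝓘(ℝ)) ∞
      (fun m ↦ TotalSpace.mk' ℝ (E := Bundle.Trivial M ℝ) m (g.inner m (X m) (Y m))) y := by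
    apply ContMDiffAt.clm_bundle_apply₂ (F₁ := E) (F₂ := E)
    · exact g.contMDiff.contMDiffAt
    · exact hy
    · exact hy'
  simp only [contMDiffAt_totalSpace] at this
  exact this.2

lemma metric_pos (g : SmoothMetric I M) {v : TangentSpace I x} (hv : v ≠ 0) :
    0 < g.inner x v v := g.pos x v hv

variable [FiniteDimensional ℝ E]

/-! ### Lie brackets and directional derivatives. -/

lemma SmoothNear.mlieBracket (h : SmoothNear X x) (h' : SmoothNear Y x) :
    SmoothNear (mlieBracket I X Y) x := by
  have : IsManifold I (minSmoothness ℝ 2) M := by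
    simp only [minSmoothness_of_isRCLikeNormedField]; infer_instance
  have : IsManifold I ((⊤ : ℕ∞) + 1) M := ‹IsManifold I ∞ M›
  filter_upwards [h, h'] with y hy hy'
  exact ContMDiffAt.mlieBracket_vectorField (n := ⊤) (m := ⊤) hy hy'
    (by simp [minSmoothness_of_isRCLikeNormedField])

/-- The bracket of vector fields is the commutator of derivations. -/
lemma mvfderiv_mlieBracket (hX : SmoothNear X x) (hY : SmoothNear Y x)
    (hf : SmoothFunNear I f x)
    (hXf : MDiffAt (fun y ↦ mvfderiv I f y (X y)) x)
    (hYf : MDiffAt (fun y ↦ mvfderiv I f y (Y y)) x) :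
    mvfderiv I f x (mlieBracket I X Y x) = mvfderiv I (fun y ↦ mvfderiv I f y (Y y)) x (X x)
      - mvfderiv I (fun y ↦ mvfderiv I f y (X y)) x (Y x) := by
  have : IsManifold I (minSmoothness ℝ 3) M := by
    simp only [minSmoothness_of_isRCLikeNormedField]
    exact IsManifold.of_le (n := ∞) ENat.LEInfty.out
  rcases subsingleton_or_nontrivial E with hE | hE
  · have h (v : TangentSpace I x) : v = 0 := Subsingleton.elim (α := E) _ _
    rw [h (mlieBracket I X Y x), h (X x), h (Y x)]
    simp
  obtain ⟨v, hv⟩ : ∃ v : TangentSpace I x, v ≠ 0 := exists_ne (0 : E)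
  let Z : Π x : M, TangentSpace I x := extend E v
  have hZx : Z x ≠ 0 := by simpa only [Z, extend_apply_self] using hv
  have hZ : SmoothNear Z x := smoothNear_extend _
  have h2 : minSmoothness ℝ 2 ≤ (∞ : ℕ∞ω) := by
    simp only [minSmoothness_of_isRCLikeNormedField]
    exact ENat.LEInfty.out
  -- The Jacobi identity is applied to f • Z and to Z. Their comparison leaves the desired identity
  -- multiplied by Z x, which is nonzero.
  have jac {W : Π x : M, TangentSpace I x} (hW : SmoothNear W x) :
      mlieBracket I X (mlieBracket I Y W) x =
      mlieBracket I (mlieBracket I X Y) W x + mlieBracket I Y (mlieBracket I X W) x :=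
    leibniz_identity_mlieBracket_apply (hX.self.of_le h2)
      (hY.self.of_le h2)
      (hW.self.of_le h2)
  -- In this expansion of [X, [Y, fZ]] the two middle terms are symmetric in X and Y, so they drop
  -- out of the commutator.
  have key {X Y : Π x : M, TangentSpace I x} (hX : SmoothNear X x) (hY : SmoothNear Y x)
      (hYf : MDiffAt (fun y ↦ mvfderiv I f y (Y y)) x) :
      mlieBracket I X (mlieBracket I Y (f • Z)) x =
        mvfderiv I (fun y ↦ mvfderiv I f y (Y y)) x (X x) • Z x
        + mvfderiv I f x (Y x) • mlieBracket I X Z x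
        + mvfderiv I f x (X x) • mlieBracket I Y Z x
        + f x • mlieBracket I X (mlieBracket I Y Z) x := by
    have h1 : mlieBracket I Y (f • Z) =ᶠ[𝓝 x]
        (fun y ↦ mvfderiv I f y (Y y)) • Z + f • mlieBracket I Y Z := by
      filter_upwards [hf.eventually, hZ.eventually] with y hy hy'
      rw [mlieBracket_smul_right hy.mdiff hy'.mdiff]
      rfl
    rw [EventuallyEq.mlieBracket_vectorField_eq (.refl _ X) h1,
      mlieBracket_add_right (hYf.smul_section hZ.mdiff)
        (hf.mdiff.smul_section (hY.mlieBracket hZ).mdiff),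
      mlieBracket_smul_right hYf hZ.mdiff,
      mlieBracket_smul_right hf.mdiff (hY.mlieBracket hZ).mdiff]
    abel
  have h1 := jac (SmoothNear.smul hf hZ)
  rw [key hX hY hYf, key hY hX hXf, mlieBracket_smul_right hf.mdiff hZ.mdiff, jac hZ] at h1
  have h2 : (mvfderiv I f x (mlieBracket I X Y x) - (mvfderiv I (fun y ↦ mvfderiv I f y (Y y)) x (X x)
      - mvfderiv I (fun y ↦ mvfderiv I f y (X y)) x (Y x))) • Z x = 0 := by
    rw [← sub_eq_zero] at h1
    rw [← neg_eq_zero, ← h1]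
    module
  exact sub_eq_zero.mp ((smul_eq_zero.mp h2).resolve_right hZx)

/-- The derivative of a smooth function along a smooth vector field is smooth. -/
lemma SmoothFunNear.mvfderiv (g : SmoothMetric I M) (hf : SmoothFunNear I f x)
    (hX : SmoothNear X x) :
    SmoothFunNear I (fun y ↦ mvfderiv I f y (X y)) x := by
  rcases subsingleton_or_nontrivial E with hE | hE
  · refine (smoothFunNear_const 0).congr (.of_forall fun y ↦ ?_)
    have h : X y = 0 := Subsingleton.elim (α := E) _ _
    rw [h, map_zero]
  obtain ⟨v, hv⟩ : ∃ v : TangentSpace I x, v ≠ 0 := exists_ne (0 : E)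
  let Z : Π x : M, TangentSpace I x := extend E v
  have hZx : Z x ≠ 0 := by simpa only [Z, extend_apply_self] using hv
  have hZ : SmoothNear Z x := smoothNear_extend _
  have hZZ := hZ.metric g hZ
  have h0 : g.inner x (Z x) (Z x) ≠ 0 := (metric_pos g hZx).ne'
  -- [X, fZ] - f[X, Z] = (Xf) Z is smooth; pairing it with Z and dividing by g(Z, Z) recovers Xf.
  have hW := (hX.mlieBracket (SmoothNear.smul hf hZ)).sub (.smul hf (hX.mlieBracket hZ))
  refine ((hW.metric g hZ).mul (hZZ.comp_of_ne (φ := fun t ↦ t⁻¹)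
    (fun t ht ↦ contDiffAt_inv ℝ ht) h0)).congr ?_
  filter_upwards [hf.eventually, hZ.eventually, hZZ.self.continuousAt.eventually_ne h0]
    with y hy hy' hy0
  have h1 : (VectorField.mlieBracket I X (f • Z) - f • VectorField.mlieBracket I X Z) y
      = _root_.mvfderiv I f y (X y) • Z y := by
    simp [mlieBracket_smul_right hy.mdiff hy'.mdiff]
  rw [h1, map_smul, _root_.smul_apply, smul_eq_mul, mul_assoc, mul_inv_cancel₀ hy0, mul_one]

end StatGeom
end

open scoped Manifold ContDiff
noncomputable section

open Bundle FiberBundle VectorField Filter Topology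

namespace StatGeom

variable {E : Type*} [NormedAddCommGroup E] [NormedSpace ℝ E]
  {H : Type*} [TopologicalSpace H] {I : ModelWithCorners ℝ E H}
  {M : Type*} [TopologicalSpace M] [ChartedSpace H M] [IsManifold I ∞ M] [FiniteDimensional ℝ E]
  {x : M}

/-! ### Orthonormal frames -/

/-- `e` is an orthonormal basis of the Euclidean space `(T_x M, g_x)`. -/
def IsOrthonormalAt (g : SmoothMetric I M) (x : M)
    (e : Fin (Module.finrank ℝ E) → TangentSpace I x) : Prop :=
  ∀ i j, g.inner x (e i) (e j) = if i = j then 1 else 0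

lemma IsOrthonormalAt.sum_smul {g : SmoothMetric I M}
    {e : Fin (Module.finrank ℝ E) → TangentSpace I x} (he : IsOrthonormalAt g x e)
    (v : TangentSpace I x) : ∑ i, g.inner x v (e i) • e i = v := by
  have coeff (c : Fin (Module.finrank ℝ E) → ℝ) (j) :
      g.inner x (∑ i, c i • e i) (e j) = c j := by
    simp [map_sum, _root_.sum_apply, he _ _]
  have _ : FiniteDimensional ℝ (TangentSpace I x) := ‹FiniteDimensional ℝ E›
  have hli : LinearIndependent ℝ e := by
    rw [Fintype.linearIndependent_iff]
    intro c hc j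
    rw [← coeff c j, hc]
    simp
  have hspan := hli.span_eq_top_of_card_eq_finrank'
    (show Fintype.card (Fin (Module.finrank ℝ E)) = Module.finrank ℝ (TangentSpace I x) from
      Fintype.card_fin _)
  have hv : v ∈ Submodule.span ℝ (Set.range e) := hspan ▸ Submodule.mem_top
  obtain ⟨c, rfl⟩ := (Submodule.mem_span_range_iff_exists_fun ℝ).mp hv
  simp only [coeff]

lemma isOrthonormalAt_onb (g : SmoothMetric I M) (x : M) : IsOrthonormalAt g x (onb g x) :=
  onb_spec g x

/-- A family of vector fields that is smooth and orthonormal near `x`. -/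
structure IsOrthonormalFrame (g : SmoothMetric I M)
    (G : Fin (Module.finrank ℝ E) → Π x : M, TangentSpace I x) (x : M) : Prop where
  smooth : ∀ i, SmoothNear (G i) x
  orthonormal : ∀ᶠ y in 𝓝 x, IsOrthonormalAt g y fun i ↦ G i y

lemma IsOrthonormalFrame.eventually {g : SmoothMetric I M}
    {G : Fin (Module.finrank ℝ E) → Π x : M, TangentSpace I x} (h : IsOrthonormalFrame g G x) :
    ∀ᶠ y in 𝓝 x, IsOrthonormalFrame g G y := by
  filter_upwards [eventually_all.mpr fun i ↦ (h.smooth i).eventually,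
    eventually_eventually_nhds.mpr h.orthonormal] with y hy hy' using ⟨hy, hy'⟩

/-- The Gram-Schmidt process applied to extensions of an orthonormal basis at `x`. -/
lemma exists_orthonormalFrame_eq_onb (g : SmoothMetric I M) (x : M) :
    ∃ G : Fin (Module.finrank ℝ E) → Π x : M, TangentSpace I x,
      IsOrthonormalFrame g G x ∧ ∀ i, G i x = onb g x i := by
  -- The induction also keeps the values at x equal to `onb g x`. This is what makes the next
  -- unnormalized vector equal to a unit vector at x, hence nonzero nearby.
  suffices h : ∀ (m : ℕ) (hm : m ≤ Module.finrank ℝ E),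
      ∃ G : Fin m → Π x : M, TangentSpace I x, (∀ i, SmoothNear (G i) x) ∧
        (∀ᶠ y in 𝓝 x, ∀ i j, g.inner y (G i y) (G j y) = if i = j then 1 else 0) ∧
        ∀ i, G i x = onb g x (Fin.castLE hm i) by
    obtain ⟨G, h1, h2, h3⟩ := h _ le_rfl
    exact ⟨G, ⟨h1, h2⟩, h3⟩
  intro m
  induction m with
  | zero => exact fun _ ↦ ⟨fun i ↦ i.elim0, fun i ↦ i.elim0, .of_forall fun _ i ↦ i.elim0,
      fun i ↦ i.elim0⟩
  | succ m ih =>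
    intro hm
    obtain ⟨G, hG, horth, hx⟩ := ih (by omega)
    let v : TangentSpace I x := onb g x ⟨m, hm⟩
    let V : Π x : M, TangentSpace I x := extend E v
    have hV : SmoothNear V x := smoothNear_extend v
    let W : Π x : M, TangentSpace I x :=
      V - fun y ↦ ∑ i, ((fun y ↦ g.inner y (V y) (G i y)) • G i) y
    have hW : SmoothNear W x := hV.sub (.sum fun i _ ↦ .smul (hV.metric g (hG i)) (hG i))
    have hWx : W x = v := by
      have (i : Fin m) : g.inner x v (G i x) = 0 := by
        rw [hx, onb_spec, if_neg]
        simp [Fin.ext_iff, i.is_lt.ne']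
      simp [W, V, this]
    have hWW := hW.metric g hW
    have hWWx : g.inner x (W x) (W x) = 1 := by rw [hWx, onb_spec, if_pos rfl]
    have h0 : g.inner x (W x) (W x) ≠ 0 := by rw [hWWx]; exact one_ne_zero
    let c : M → ℝ := fun y ↦ (√(g.inner y (W y) (W y)))⁻¹
    have hc : SmoothFunNear I c x := hWW.comp_of_ne (φ := fun t ↦ (√t)⁻¹) (fun t ht ↦ by
      by_cases h : 0 < t
      · exact (Real.contDiffAt_sqrt ht).inv (Real.sqrt_pos.mpr h).ne'
      -- For t < 0 both the square root and the inverse take the default value 0, so the function is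
      -- locally constant.
      · refine contDiffAt_const (c := (0 : ℝ)) |>.congr_of_eventuallyEq ?_
        filter_upwards [eventually_lt_nhds (lt_of_le_of_ne (not_lt.mp h) ht)] with s hs
        simp [Real.sqrt_eq_zero_of_nonpos hs.le]) h0
    refine ⟨Fin.snoc G (c • W), ?_, ?_, ?_⟩
    · intro i
      refine Fin.lastCases ?_ (fun i ↦ ?_) i
      · simpa using SmoothNear.smul hc hW
      · simpa using hG i
    · filter_upwards [horth, hWW.self.continuousAt.eventually_ne h0] with y hy hy0
      have hpos : 0 < g.inner y (W y) (W y) := by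
        refine metric_pos g fun h ↦ hy0 ?_
        simp [h]
      have horthW (i : Fin m) : g.inner y (W y) (G i y) = 0 := by
        simp [W, map_sum, _root_.sum_apply, hy]
      have h1 : c y * (c y * g.inner y (W y) (W y)) = 1 := by
        have := Real.sqrt_pos.mpr hpos
        have h2 := Real.mul_self_sqrt hpos.le
        simp only [c]
        field_simp
        rw [sq, h2]
      intro i j
      refine Fin.lastCases ?_ (fun i ↦ ?_) i <;> refine Fin.lastCases ?_ (fun j ↦ ?_) j
      · simpa using h1
      · simp [horthW, (Fin.castSucc_lt_last j).ne']
      · simp [g.symm y (G i y) (W y), horthW, (Fin.castSucc_lt_last i).ne]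
      · simp [hy, Fin.ext_iff]
    · intro i
      refine Fin.lastCases ?_ (fun i ↦ ?_) i
      · have : c x = 1 := by simp [c, hWWx]
        simp [this, hWx, v]
        try rfl
      · simp [hx]
        try rfl

lemma exists_orthonormalFrame (g : SmoothMetric I M) (x : M) :
    ∃ G : Fin (Module.finrank ℝ E) → Π x : M, TangentSpace I x, IsOrthonormalFrame g G x :=
  (exists_orthonormalFrame_eq_onb g x).imp fun _ ↦ And.left

/-! ### Smoothness of connections -/

/-- The covariant derivative `∇_X Y` as a vector field. -/
abbrev cov (D : Connection I M) (X Y : Π x : M, TangentSpace I x) : Π x : M, TangentSpace I x :=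
  fun y ↦ D Y y (X y)

/-- `∇_X Y` is smooth for smooth vector fields `X` and `Y`. -/
def PreservesSmooth (D : Connection I M) : Prop :=
  ∀ ⦃X Y : Π x : M, TangentSpace I x⦄ ⦃x : M⦄, SmoothNear X x → SmoothNear Y x →
    SmoothNear (cov D X Y) x

/-- By the Koszul formula the components of ∇̂_X Y in a smooth orthonormal frame are combinations of
derivatives and brackets of smooth data. -/
lemma preservesSmooth_leviCivita (g : SmoothMetric I M) : PreservesSmooth (leviCivita g) := by
  intro X Y x hX hY
  obtain ⟨G, hG⟩ := exists_orthonormalFrame g x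
  have key {Z : Π x : M, TangentSpace I x} (hZ : SmoothNear Z x) :
      SmoothFunNear I (fun y ↦ g.inner y (leviCivita g Y y (X y)) (Z y)) x := by
    refine ((smoothFunNear_const (1 / 2)).mul (f' := koszul g X Y Z) ?_).congr ?_
    · exact ((((((hY.metric g hZ).mvfderiv g hX).add ((hX.metric g hZ).mvfderiv g hY)).sub
        ((hX.metric g hY).mvfderiv g hZ)).add ((hX.mlieBracket hY).metric g hZ)).sub
        ((hX.mlieBracket hZ).metric g hY)).sub ((hY.mlieBracket hZ).metric g hX)
    · filter_upwards [hX.eventually, hY.eventually, hZ.eventually] with y h1 h2 h3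
      rw [← koszul_formula g h1.mdiff h2.mdiff h3.mdiff]
      ring
  refine (SmoothNear.sum (s := Finset.univ) fun i _ ↦
    SmoothNear.smul (key (hG.smooth i)) (hG.smooth i)).congr ?_
  filter_upwards [hG.orthonormal] with y hy
  exact (hy.sum_smul _).symm

/-- The smoothness assumption on `D` speaks of globally smooth sections. A field smooth near x is
made global by a bump function equal to 1 near x, and `D` is local. Hausdorffness provides the bump
function. -/
lemma preservesSmooth_of_contMDiff [T2Space M] {D : Connection I M}
    (hD : D.ContMDiffCovariantDerivative ∞) : PreservesSmooth D := by
  intro X Y x hX hY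
  obtain ⟨u, hu, huo, hxu⟩ := eventually_nhds_iff.mp hY
  obtain ⟨φ, -, hφ⟩ := (SmoothBumpFunction.nhds_basis_tsupport (I := I) x).mem_iff.mp
    (huo.mem_nhds hxu)
  have h1 : CMDiff ∞ (T% ((φ : M → ℝ) • Y)) :=
    ContMDiffOn.smul_section_of_tsupport φ.contMDiff.contMDiffOn huo hφ
      fun y hy ↦ (hu y hy).contMDiffWithinAt
  have h2 := hD.contMDiff.contMDiff (σ := (φ : M → ℝ) • Y) (contMDiffOn_univ.mpr h1)
  rw [contMDiffOn_univ] at h2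
  filter_upwards [hX, hY.eventually, eventually_eventually_nhds.mpr φ.eventuallyEq_one]
    with y hy hy' hφy
  refine ((h2 y).clm_bundle_apply (v := X) hy).congr_of_eventuallyEq ?_
  filter_upwards [hy'.eventually, eventually_eventually_nhds.mpr hφy] with z hz hφz
  have : D Y z = D ((φ : M → ℝ) • Y) z := by
    refine D.isCovariantDerivativeOnUniv.congr_of_eventuallyEq hz.mdiff
      (h1 z |>.mdifferentiableAt (by simp)) univ_mem ?_
    filter_upwards [hφz] with w hw
    simp [hw]
  rw [cov, this]

/-! ### Tensoriality -/

lemma mvfderiv_congr {f f' : M → ℝ} (h : ∀ᶠ y in 𝓝 x, f y = f' y) (v : TangentSpace I x) :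
    mvfderiv I f x v = mvfderiv I f' x v := by
  have h' : f =ᶠ[𝓝 x] f' := h
  exact DFunLike.congr_fun (F := E →L[ℝ] ℝ) h'.mfderiv_eq v

/-- An operation on smooth vector fields that is linear over smooth functions depends only on the
value at the point. -/
lemma eq_of_linear (g : SmoothMetric I M) {Φ : (Π x : M, TangentSpace I x) → ℝ}
    (hadd : ∀ X Y, SmoothNear X x → SmoothNear Y x → Φ (X + Y) = Φ X + Φ Y)
    (hsmul : ∀ f X, SmoothFunNear I f x → SmoothNear X x → Φ (f • X) = f x * Φ X)
    {X Y : Π x : M, TangentSpace I x} (hX : SmoothNear X x) (hY : SmoothNear Y x)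
    (h : X x = Y x) : Φ X = Φ Y := by
  classical
  -- Locality without bump functions: the indicator ψ of {X = Y} need only be smooth near x, where
  -- it is 1, while ψX = ψY holds everywhere.
  have hloc {X Y : Π x : M, TangentSpace I x} (hX : SmoothNear X x) (hY : SmoothNear Y x)
      (h : ∀ᶠ y in 𝓝 x, X y = Y y) : Φ X = Φ Y := by
    let ψ : M → ℝ := fun y ↦ if X y = Y y then 1 else 0
    have hψ : SmoothFunNear I ψ x := (smoothFunNear_const 1).congr (h.mono fun y hy ↦ by simp [ψ, hy])
    have hψx : ψ x = 1 := by simp [ψ, h.self_of_nhds]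
    have hXY : ψ • X = ψ • Y := by
      ext1 y
      by_cases hy : X y = Y y <;> simp [ψ, hy]
    have := congrArg Φ hXY
    rwa [hsmul _ _ hψ hX, hsmul _ _ hψ hY, hψx, one_mul, one_mul] at this
  obtain ⟨G, hG⟩ := exists_orthonormalFrame g x
  have hsum {W : Fin (Module.finrank ℝ E) → Π x : M, TangentSpace I x} (hW : ∀ i, SmoothNear (W i) x)
      (s : Finset (Fin (Module.finrank ℝ E))) : Φ (fun y ↦ ∑ i ∈ s, W i y) = ∑ i ∈ s, Φ (W i) := by
    induction s using Finset.induction_on with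
    | empty =>
      have := hsmul (fun _ ↦ 0) (fun y ↦ 0) (smoothFunNear_const 0) smoothNear_zero
      rw [zero_mul] at this
      rw [Finset.sum_empty, ← this]
      congr 1
      ext1 y
      simp
    | insert i s hi ih =>
      simp only [Finset.sum_insert hi]
      rw [← ih]
      exact hadd _ _ (hW i) (.sum fun i _ ↦ hW i)
  -- Near x the field is its expansion in the frame, so locality and linearity express Φ X through
  -- the components of X at x.
  have hexp {X : Π x : M, TangentSpace I x} (hX : SmoothNear X x) :
      Φ X = ∑ i, g.inner x (X x) (G i x) * Φ (G i) := by
    have h1 (i) : SmoothNear ((fun y ↦ g.inner y (X y) (G i y)) • G i) x :=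
      .smul (hX.metric g (hG.smooth i)) (hG.smooth i)
    rw [hloc hX (.sum (s := Finset.univ) fun i _ ↦ h1 i), hsum h1]
    · exact Finset.sum_congr rfl fun i _ ↦ hsmul _ _ (hX.metric g (hG.smooth i)) (hG.smooth i)
    · filter_upwards [hG.orthonormal] with y hy using (hy.sum_smul _).symm
  rw [hexp hX, hexp hY, h]

/-! ### Smooth tensor fields and their covariant derivatives. -/

/-- `T` is a smooth tensor field on `U`. -/
structure IsTensorOn {k : ℕ} (T : TensorField I M k) (U : Set M) : Prop where
  smooth : ∀ {x : M}, x ∈ U → ∀ {X : Fin k → Π x : M, TangentSpace I x},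
    (∀ a, SmoothNear (X a) x) → SmoothFunNear I (T X) x
  tensorial : ∀ {x : M}, x ∈ U → ∃ t : MultilinearMap ℝ (fun _ : Fin k ↦ TangentSpace I x) ℝ,
    ∀ {X : Fin k → Π x : M, TangentSpace I x}, (∀ a, SmoothNear (X a) x) →
      T X x = t fun a ↦ X a x

lemma SmoothNear.update {k : ℕ} {X : Fin k → Π x : M, TangentSpace I x} {a : Fin k}
    {Y : Π x : M, TangentSpace I x} (hX : ∀ a, SmoothNear (X a) x) (hY : SmoothNear Y x)
    (b : Fin k) : SmoothNear (Function.update X a Y b) x := by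
  by_cases h : b = a
  · subst h; simpa using hY
  · simpa [h] using hX b

/-- By `eq_of_linear` each slot depends only on the value of its argument at x. The multilinear form
is T evaluated on canonical extensions. -/
lemma exists_multilinear (g : SmoothMetric I M) {k : ℕ} {T : TensorField I M k}
    (hadd : ∀ (X : Fin k → Π x : M, TangentSpace I x) (a Y Z), (∀ a, SmoothNear (X a) x) →
      SmoothNear Y x → SmoothNear Z x → T (Function.update X a (Y + Z)) x =
        T (Function.update X a Y) x + T (Function.update X a Z) x)
    (hsmul : ∀ (X : Fin k → Π x : M, TangentSpace I x) (a f Y), (∀ a, SmoothNear (X a) x) →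
      SmoothFunNear I f x → SmoothNear Y x → T (Function.update X a (f • Y)) x =
        f x * T (Function.update X a Y) x) :
    ∃ t : MultilinearMap ℝ (fun _ : Fin k ↦ TangentSpace I x) ℝ,
      ∀ {X : Fin k → Π x : M, TangentSpace I x}, (∀ a, SmoothNear (X a) x) →
        T X x = t fun a ↦ X a x := by
  have slot {X : Fin k → Π x : M, TangentSpace I x} {a Y Z} (hX : ∀ a, SmoothNear (X a) x)
      (hY : SmoothNear Y x) (hZ : SmoothNear Z x) (h : Y x = Z x) :
      T (Function.update X a Y) x = T (Function.update X a Z) x :=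
    eq_of_linear g (Φ := fun Y ↦ T (Function.update X a Y) x)
      (fun Y Z hY hZ ↦ hadd X a Y Z hX hY hZ) (fun f Y hf hY ↦ hsmul X a f Y hX hf hY) hY hZ h
  have hext (v : Fin k → TangentSpace I x) (a) : SmoothNear (extend E (v a)) x :=
    smoothNear_extend _
  have hupd (v : Fin k → TangentSpace I x) (a p) : (fun b ↦ extend E (Function.update v a p b)) =
      Function.update (fun b ↦ extend E (v b)) a (extend E p) := by
    ext1 b
    by_cases h : b = a
    · subst h; simp
    · simp [h]
  refine ⟨⟨fun v ↦ T (fun a ↦ extend E (v a)) x, ?_, ?_⟩, ?_⟩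
  · intro inst v a p q
    -- The laws of a `MultilinearMap` are stated for an arbitrary decidability instance.
    rw [Subsingleton.elim inst (instDecidableEqFin k)]
    simp only [hupd]
    rw [← hadd _ _ _ _ (hext v) (smoothNear_extend _) (smoothNear_extend _)]
    exact slot (hext v) (smoothNear_extend _) ((smoothNear_extend _).add (smoothNear_extend _))
      (by simp)
  · intro inst v a c p
    rw [Subsingleton.elim inst (instDecidableEqFin k)]
    simp only [hupd, smul_eq_mul]
    rw [← hsmul _ _ (fun _ ↦ c) _ (hext v) (smoothFunNear_const c) (smoothNear_extend _)]
    exact slot (hext v) (smoothNear_extend _) (.smul (smoothFunNear_const c) (smoothNear_extend _))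
      (by simp)
  · intro X hX
    let X' : Fin k → Π x : M, TangentSpace I x := fun a ↦ extend E (X a x)
    have hX' (a) : SmoothNear (X' a) x := smoothNear_extend _
    -- The arguments are replaced by canonical extensions one slot at a time.
    have hpw (s : Finset (Fin k)) : T (s.piecewise X' X) x = T X x := by
      induction s using Finset.induction_on with
      | empty => simp
      | insert a s ha ih =>
        have hs (b) : SmoothNear (s.piecewise X' X b) x := by
          by_cases h : b ∈ s <;> simp [h, hX, hX']
        have h1 : s.piecewise X' X = Function.update (s.piecewise X' X) a (X a) := by
          rw [eq_comm, Function.update_eq_self_iff]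
          simp [ha]
        rw [Finset.piecewise_insert, slot hs (hX' a) (hX a) (by simp [X']), ← h1, ih]
    have := hpw Finset.univ
    rw [Finset.piecewise_univ] at this
    exact this.symm

lemma IsTensorOn.eq_of_eq {k : ℕ} {T : TensorField I M k} {U : Set M} (hT : IsTensorOn T U)
    (hx : x ∈ U) {X Y : Fin k → Π x : M, TangentSpace I x} (hX : ∀ a, SmoothNear (X a) x)
    (hY : ∀ a, SmoothNear (Y a) x) (h : ∀ a, X a x = Y a x) : T X x = T Y x := by
  obtain ⟨t, ht⟩ := hT.tensorial hx
  rw [ht hX, ht hY]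
  exact congrArg t (funext h)

section covDeriv

variable {k : ℕ} {T : TensorField I M k} {U : Set M} {D : Connection I M}

lemma SmoothNear.tail {X : Fin (k + 1) → Π x : M, TangentSpace I x}
    (hX : ∀ a, SmoothNear (X a) x) (a : Fin k) : SmoothNear (Fin.tail X a) x := hX a.succ

lemma covDeriv_apply (hD : PreservesSmooth D)
    {t : MultilinearMap ℝ (fun _ : Fin k ↦ TangentSpace I x) ℝ}
    (ht : ∀ {X : Fin k → Π x : M, TangentSpace I x}, (∀ a, SmoothNear (X a) x) →
        T X x = t fun a ↦ X a x) {X : Fin (k + 1) → Π x : M, TangentSpace I x}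
    (hX : ∀ a, SmoothNear (X a) x) :
    covDeriv D T X x = mvfderiv I (T (Fin.tail X)) x (X 0 x) -
      ∑ a, t (Function.update (fun b ↦ X b.succ x) a (D (X a.succ) x (X 0 x))) := by
  rw [covDeriv]
  congr 1
  refine Finset.sum_congr rfl fun a _ ↦ ?_
  refine (ht (SmoothNear.update (SmoothNear.tail hX) (hD (hX 0) (hX a.succ)))).trans ?_
  congr 1
  ext1 b
  by_cases h : b = a
  · subst h; simp
  · simp [h, Fin.tail]

/-- The term in which `D` hits the replaced slot `b` is set apart: it is the only correction term
that is not pointwise in Y, and it must be matched with the derivative of T in that slot. -/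
lemma covDeriv_update_succ (hD : PreservesSmooth D)
    {t : MultilinearMap ℝ (fun _ : Fin k ↦ TangentSpace I x) ℝ}
    (ht : ∀ {X : Fin k → Π x : M, TangentSpace I x}, (∀ a, SmoothNear (X a) x) →
        T X x = t fun a ↦ X a x) {X : Fin (k + 1) → Π x : M, TangentSpace I x}
    (hX : ∀ a, SmoothNear (X a) x) (b : Fin k) {Y : Π x : M, TangentSpace I x}
    (hY : SmoothNear Y x) :
    covDeriv D T (Function.update X b.succ Y) x =
      mvfderiv I (T (Function.update (Fin.tail X) b Y)) x (X 0 x) -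
      (t (Function.update (fun b ↦ X b.succ x) b (D Y x (X 0 x)))
        + ∑ a ∈ Finset.univ.erase b, t (Function.update
          (Function.update (fun b ↦ X b.succ x) a (D (X a.succ) x (X 0 x))) b (Y x))) := by
  have hv : (fun a : Fin k ↦ Function.update X b.succ Y a.succ x) =
      Function.update (fun b ↦ X b.succ x) b (Y x) := by
    ext1 a
    by_cases h : a = b
    · subst h; simp
    · simp [h]
  rw [covDeriv_apply hD ht (SmoothNear.update hX hY), Fin.tail_update_succ, hv,
    Function.update_of_ne (Fin.succ_ne_zero b).symm, ← Finset.add_sum_erase _ _ (Finset.mem_univ b)]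
  congr 2
  · simp
  · refine Finset.sum_congr rfl fun a ha ↦ ?_
    have hab := Finset.ne_of_mem_erase ha
    rw [Function.update_of_ne (by simpa using hab), Function.update_comm hab]

/-- The covariant derivative of a smooth tensor field is a smooth tensor field. -/
lemma IsTensorOn.covDeriv (g : SmoothMetric I M) (hT : IsTensorOn T U) (hU : IsOpen U)
    (hD : PreservesSmooth D) : IsTensorOn (covDeriv D T) U where
  smooth {x} hx X hX := ((hT.smooth hx (SmoothNear.tail hX)).mvfderiv g (hX 0)).sub
    (.sum fun a _ ↦ hT.smooth hx (SmoothNear.update (SmoothNear.tail hX) (hD (hX 0) (hX a.succ))))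
  tensorial {x} hx := by
    have hnear : ∀ᶠ y in 𝓝 x, y ∈ U := hU.mem_nhds hx
    obtain ⟨t, ht⟩ := hT.tensorial hx
    apply exists_multilinear g
    · intro X a Y Z hX hY hZ
      refine Fin.cases ?_ (fun b ↦ ?_) a
      · rw [covDeriv_apply hD ht (SmoothNear.update hX (hY.add hZ)),
          covDeriv_apply hD ht (SmoothNear.update hX hY),
          covDeriv_apply hD ht (SmoothNear.update hX hZ)]
        simp only [Fin.tail_update_zero, Function.update_self, Pi.add_apply, map_add,
          Function.update_of_ne (Fin.succ_ne_zero _), MultilinearMap.map_update_add,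
          Finset.sum_add_distrib]
        ring
      · rw [covDeriv_update_succ hD ht hX b hY, covDeriv_update_succ hD ht hX b hZ,
          covDeriv_update_succ hD ht hX b (hY.add hZ),
          D.isCovariantDerivativeOnUniv.add hY.mdiff hZ.mdiff,
          mvfderiv_congr (f' := fun y ↦ T (Function.update (Fin.tail X) b Y) y +
            T (Function.update (Fin.tail X) b Z) y),
          mvfderiv_fun_add (hT.smooth hx (SmoothNear.update (SmoothNear.tail hX) hY)).mdiff
            (hT.smooth hx (SmoothNear.update (SmoothNear.tail hX) hZ)).mdiff]
        · simp only [_root_.add_apply, Pi.add_apply, MultilinearMap.map_update_add,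
            Finset.sum_add_distrib]
          ring
        · filter_upwards [hnear, eventually_all.mpr fun a ↦ (hX a).eventually, hY.eventually,
            hZ.eventually] with y hy hXy hYy hZy
          obtain ⟨s, hs⟩ := hT.tensorial hy
          rw [hs (SmoothNear.update (SmoothNear.tail hXy) hYy),
            hs (SmoothNear.update (SmoothNear.tail hXy) hZy),
            hs (SmoothNear.update (SmoothNear.tail hXy) (hYy.add hZy))]
          have hu (W : Π x : M, TangentSpace I x) :
              (fun a ↦ Function.update (Fin.tail X) b W a y) =
              Function.update (fun a ↦ Fin.tail X a y) b (W y) := by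
            ext1 a
            by_cases h : a = b
            · subst h; simp
            · simp [h]
          simp only [hu, Pi.add_apply, MultilinearMap.map_update_add]
    · intro X a f Y hX hf hY
      refine Fin.cases ?_ (fun b ↦ ?_) a
      · rw [covDeriv_apply hD ht (SmoothNear.update hX (.smul hf hY)),
          covDeriv_apply hD ht (SmoothNear.update hX hY)]
        simp only [Fin.tail_update_zero, Function.update_self, Pi.smul_apply', map_smul,
          Function.update_of_ne (Fin.succ_ne_zero _), MultilinearMap.map_update_smul,
          smul_eq_mul, ← Finset.mul_sum]
        ring
      -- The term (X₀ f) T(…, Y, …) from the product rule cancels the one from the Leibniz rule for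
      -- `D` in slot `b`.
      · rw [covDeriv_update_succ hD ht hX b hY, covDeriv_update_succ hD ht hX b (.smul hf hY),
          D.isCovariantDerivativeOnUniv.leibniz hY.mdiff hf.mdiff,
          mvfderiv_congr (f' := fun y ↦ f y * T (Function.update (Fin.tail X) b Y) y),
          mvfderiv_fun_mul hf.mdiff
            (hT.smooth hx (SmoothNear.update (SmoothNear.tail hX) hY)).mdiff,
          ht (SmoothNear.update (SmoothNear.tail hX) hY)]
        · have hu : (fun a ↦ Function.update (Fin.tail X) b Y a x) =
              Function.update (fun b ↦ X b.succ x) b (Y x) := by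
            ext1 a
            by_cases h : a = b
            · subst h; simp
            · simp [h, Fin.tail]
          simp only [hu, _root_.add_apply, _root_.smul_apply, Pi.smul_apply',
            ContinuousLinearMap.smulRight_apply, MultilinearMap.map_update_add,
            MultilinearMap.map_update_smul, smul_eq_mul, ← Finset.mul_sum]
          ring
        · filter_upwards [hnear, eventually_all.mpr fun a ↦ (hX a).eventually, hY.eventually,
            hf.eventually] with y hy hXy hYy hfy
          obtain ⟨s, hs⟩ := hT.tensorial hy
          rw [hs (SmoothNear.update (SmoothNear.tail hXy) hYy),
            hs (SmoothNear.update (SmoothNear.tail hXy) (.smul hfy hYy))]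
          have hu (W : Π x : M, TangentSpace I x) :
              (fun a ↦ Function.update (Fin.tail X) b W a y) =
              Function.update (fun a ↦ Fin.tail X a y) b (W y) := by
            ext1 a
            by_cases h : a = b
            · subst h; simp
            · simp [h]
          simp only [hu, Pi.smul_apply', MultilinearMap.map_update_smul, smul_eq_mul]

end covDeriv

/-! ### Contractions in orthonormal frames -/

lemma IsOrthonormalAt.sum_inner_mul {g : SmoothMetric I M}
    {e : Fin (Module.finrank ℝ E) → TangentSpace I x} (he : IsOrthonormalAt g x e)
    (v w : TangentSpace I x) : ∑ i, g.inner x (e i) v * g.inner x (e i) w = g.inner x v w := by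
  conv_rhs => rw [← he.sum_smul v]
  simp only [map_sum, map_smul, _root_.sum_apply, _root_.smul_apply, smul_eq_mul, g.symm x v]

/-- The scalar product of two multilinear forms does not depend on the orthonormal basis. -/
lemma IsOrthonormalAt.sum_mul_eq {g : SmoothMetric I M} {k : ℕ}
    {e f : Fin (Module.finrank ℝ E) → TangentSpace I x} (he : IsOrthonormalAt g x e)
    (hf : IsOrthonormalAt g x f)
    (s t : MultilinearMap ℝ (fun _ : Fin k ↦ TangentSpace I x) ℝ) :
    ∑ i : Fin k → Fin (Module.finrank ℝ E), s (fun a ↦ e (i a)) * t (fun a ↦ e (i a)) =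
      ∑ i : Fin k → Fin (Module.finrank ℝ E), s (fun a ↦ f (i a)) * t (fun a ↦ f (i a)) := by
  have hexp (s : MultilinearMap ℝ (fun _ : Fin k ↦ TangentSpace I x) ℝ)
      (i : Fin k → Fin (Module.finrank ℝ E)) : s (fun a ↦ e (i a)) =
      ∑ r : Fin k → Fin (Module.finrank ℝ E),
        (∏ a, g.inner x (e (i a)) (f (r a))) * s (fun a ↦ f (r a)) := by
    have h1 : (fun a ↦ e (i a)) =
        fun a ↦ ∑ r, g.inner x (e (i a)) (f r) • f r := by
      ext1 a
      exact (hf.sum_smul _).symm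
    rw [h1, MultilinearMap.map_sum]
    exact Finset.sum_congr rfl fun r _ ↦ s.map_smul_univ _ _
  -- The sum over multi-indices factors into one sum per slot, each an orthogonality relation of the
  -- change-of-basis matrix.
  have horth (r q : Fin k → Fin (Module.finrank ℝ E)) :
      ∑ i : Fin k → Fin (Module.finrank ℝ E), (∏ a, g.inner x (e (i a)) (f (r a))) *
        (∏ a, g.inner x (e (i a)) (f (q a))) = if r = q then 1 else 0 := by
    simp only [← Finset.prod_mul_distrib]
    rw [← Fintype.piFinset_univ, ← Finset.prod_univ_sum
      (f := fun a i ↦ g.inner x (e i) (f (r a)) * g.inner x (e i) (f (q a)))]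
    simp only [he.sum_inner_mul, hf _ _, Finset.prod_ite_zero, Finset.prod_const_one,
      Finset.mem_univ, true_implies, funext_iff]
  calc _ = ∑ i : Fin k → Fin (Module.finrank ℝ E), ∑ r : Fin k → Fin (Module.finrank ℝ E),
        ∑ q : Fin k → Fin (Module.finrank ℝ E), ((∏ a, g.inner x (e (i a)) (f (r a))) *
          (∏ a, g.inner x (e (i a)) (f (q a)))) * (s (fun a ↦ f (r a)) * t (fun a ↦ f (q a))) := by
        refine Finset.sum_congr rfl fun i _ ↦ ?_
        rw [hexp s, hexp t, Finset.sum_mul_sum]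
        exact Finset.sum_congr rfl fun r _ ↦ Finset.sum_congr rfl fun q _ ↦ by ring
    _ = ∑ r : Fin k → Fin (Module.finrank ℝ E), ∑ q : Fin k → Fin (Module.finrank ℝ E),
        ∑ i : Fin k → Fin (Module.finrank ℝ E), ((∏ a, g.inner x (e (i a)) (f (r a))) *
          (∏ a, g.inner x (e (i a)) (f (q a)))) * (s (fun a ↦ f (r a)) * t (fun a ↦ f (q a))) := by
        rw [Finset.sum_comm]
        exact Finset.sum_congr rfl fun r _ ↦ Finset.sum_comm
    _ = _ := by
        simp only [← Finset.sum_mul, horth, ite_mul, one_mul, zero_mul, Finset.sum_ite_eq,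
          Finset.mem_univ, if_true]

/-- Exchanging the index i a with l is an involution that preserves the bracket and reverses the
sign of c, so the terms cancel in pairs. With c the connection form, this says that the rotation of
an orthonormal frame does not affect a scalar product. -/
lemma sum_antisymm_update {n k : ℕ} {c : Fin n → Fin n → ℝ} (hc : ∀ p q, c p q = -c q p)
    (S T : (Fin k → Fin n) → ℝ) (a : Fin k) :
    ∑ i, ∑ l, c (i a) l * (S (Function.update i a l) * T i + S i * T (Function.update i a l))
      = 0 := by
  rw [← Fintype.sum_prod_type' (f := fun i l ↦
    c (i a) l * (S (Function.update i a l) * T i + S i * T (Function.update i a l)))]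
  have h (p : (Fin k → Fin n) × Fin n) :
      c (p.1 a) p.2 * (S (Function.update p.1 a p.2) * T p.1 + S p.1 * T (Function.update p.1 a p.2))
      + c (Function.update p.1 a p.2 a) (p.1 a) *
        (S (Function.update (Function.update p.1 a p.2) a (p.1 a)) * T (Function.update p.1 a p.2)
        + S (Function.update p.1 a p.2) *
          T (Function.update (Function.update p.1 a p.2) a (p.1 a))) = 0 := by
    simp only [Function.update_self, Function.update_idem, Function.update_eq_self]
    rw [hc p.2]
    ring
  refine Finset.sum_involution (fun p _ ↦ (Function.update p.1 a p.2, p.1 a)) (fun p _ ↦ h p)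
    (fun p _ hp hp' ↦ hp ?_) (fun _ _ ↦ Finset.mem_univ _) (fun p _ ↦ by simp)
  -- At a fixed point of the involution a term is its own negative, hence zero.
  have h1 := h p
  obtain ⟨h2, h3⟩ := Prod.ext_iff.mp hp'
  simp only at h2 h3
  rw [h2, h3, h2] at h1
  rw [h2, h3]
  linarith

lemma mvfderiv_sum {ι : Type*} {s : Finset ι} {f : ι → M → ℝ} (hf : ∀ i ∈ s, SmoothFunNear I (f i) x)
    (v : TangentSpace I x) :
    mvfderiv I (fun y ↦ ∑ i ∈ s, f i y) x v = ∑ i ∈ s, mvfderiv I (f i) x v := by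
  classical
  induction s using Finset.induction_on with
  | empty => simp [mvfderiv_const]
  | insert i s hi ih =>
    simp only [Finset.sum_insert hi]
    have h2 : MDiffAt (fun y ↦ ∑ i ∈ s, f i y) x :=
      (SmoothFunNear.sum fun i hi ↦ hf i (Finset.mem_insert_of_mem hi)).mdiff
    rw [mvfderiv_fun_add (hf i (Finset.mem_insert_self i s)).mdiff h2, _root_.add_apply,
      ih fun i hi ↦ hf i (Finset.mem_insert_of_mem hi)]

section

variable {g : SmoothMetric I M} {G : Fin (Module.finrank ℝ E) → Π x : M, TangentSpace I x}

/-- The connection form of the Levi-Civita connection in an orthonormal frame is skew. -/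
lemma IsOrthonormalFrame.skew (hG : IsOrthonormalFrame g G x) {Y : Π x : M, TangentSpace I x}
    (hY : SmoothNear Y x) (p q : Fin (Module.finrank ℝ E)) :
    g.inner x (leviCivita g (G p) x (Y x)) (G q x) =
      -g.inner x (leviCivita g (G q) x (Y x)) (G p x) := by
  have h := leviCivita_metric g hY.mdiff (hG.smooth p).mdiff (hG.smooth q).mdiff
  rw [mvfderiv_congr (f' := fun _ ↦ if p = q then (1 : ℝ) else 0)
    (hG.orthonormal.mono fun y hy ↦ hy p q), mvfderiv_const] at h
  rw [g.symm x (leviCivita g (G q) x (Y x))]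
  simp only [_root_.zero_apply] at h
  linarith

lemma IsOrthonormalFrame.cov_eq (hG : IsOrthonormalFrame g G x) (Y : Π x : M, TangentSpace I x)
    (p : Fin (Module.finrank ℝ E)) : leviCivita g (G p) x (Y x) =
      ∑ q, g.inner x (leviCivita g (G p) x (Y x)) (G q x) • G q x :=
  (hG.orthonormal.self_of_nhds.sum_smul _).symm

lemma SmoothNear.finCons {k : ℕ} {Y : Π x : M, TangentSpace I x}
    {X : Fin k → Π x : M, TangentSpace I x} (hY : SmoothNear Y x) (hX : ∀ a, SmoothNear (X a) x) :
    ∀ a, SmoothNear ((Fin.cons Y X : Fin (k + 1) → Π x : M, TangentSpace I x) a) x :=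
  Fin.cases hY hX

/-- The product rule for the scalar product of tensor fields. -/
lemma mvfderiv_inner {k : ℕ} {S T : TensorField I M k} {U : Set M} (hS : IsTensorOn S U)
    (hT : IsTensorOn T U) (hx : x ∈ U) (hG : IsOrthonormalFrame g G x)
    {Y : Π x : M, TangentSpace I x} (hY : SmoothNear Y x) :
    mvfderiv I (fun y ↦ ∑ i : Fin k → Fin (Module.finrank ℝ E),
        S (fun a ↦ G (i a)) y * T (fun a ↦ G (i a)) y) x (Y x) =
      ∑ i : Fin k → Fin (Module.finrank ℝ E),
        (covDeriv (leviCivita g) S (Fin.cons Y fun a ↦ G (i a)) x * T (fun a ↦ G (i a)) x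
        + S (fun a ↦ G (i a)) x * covDeriv (leviCivita g) T (Fin.cons Y fun a ↦ G (i a)) x) := by
  have hs (i : Fin k → Fin (Module.finrank ℝ E)) : ∀ a, SmoothNear (G (i a)) x :=
    fun a ↦ hG.smooth _
  have hD := preservesSmooth_leviCivita g
  obtain ⟨s, hs'⟩ := hS.tensorial hx
  obtain ⟨t, ht'⟩ := hT.tensorial hx
  rw [mvfderiv_sum fun i _ ↦ (hS.smooth hx (hs i)).mul (hT.smooth hx (hs i))]
  have hupd (i : Fin k → Fin (Module.finrank ℝ E)) (a l) :
      Function.update (fun b ↦ G (i b) x) a (G l x) = fun b ↦ G (Function.update i a l b) x := by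
    ext1 b
    by_cases h : b = a
    · subst h; simp
    · simp [h]
  have hexp (u : MultilinearMap ℝ (fun _ : Fin k ↦ TangentSpace I x) ℝ)
      (i : Fin k → Fin (Module.finrank ℝ E)) (a) :
      u (Function.update (fun b ↦ G (i b) x) a (leviCivita g (G (i a)) x (Y x))) =
      ∑ l, g.inner x (leviCivita g (G (i a)) x (Y x)) (G l x) *
        u (fun b ↦ G (Function.update i a l b) x) := by
    rw [hG.cov_eq, MultilinearMap.map_update_sum]
    simp only [MultilinearMap.map_update_smul, hupd, smul_eq_mul, ← hG.cov_eq]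
  -- These are exactly the connection terms separating the derivatives of the components from the
  -- components of ∇̂S and ∇̂T.
  have hzero := Finset.sum_congr rfl fun a (_ : a ∈ Finset.univ) ↦
    sum_antisymm_update (hG.skew hY) (fun i ↦ s fun b ↦ G (i b) x) (fun i ↦ t fun b ↦ G (i b) x) a
  rw [Finset.sum_comm, Finset.sum_const_zero] at hzero
  rw [← sub_eq_zero, ← Finset.sum_sub_distrib, ← hzero]
  refine Finset.sum_congr rfl fun i _ ↦ ?_
  rw [mvfderiv_fun_mul (hS.smooth hx (hs i)).mdiff (hT.smooth hx (hs i)).mdiff,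
    covDeriv_apply hD hs' (hY.finCons (hs i)), covDeriv_apply hD ht' (hY.finCons (hs i)),
    hs' (hs i), ht' (hs i)]
  simp only [Fin.cons_succ, Fin.cons_zero, Fin.tail_cons, hexp, _root_.add_apply,
    _root_.smul_apply, smul_eq_mul]
  have hsplit (p q r : Fin k → Fin (Module.finrank ℝ E) → ℝ) (c d : ℝ) :
      ∑ a, ∑ l, p a l * (q a l * c + d * r a l) =
        (∑ a, ∑ l, p a l * q a l) * c + d * ∑ a, ∑ l, p a l * r a l := by
    simp only [Finset.sum_mul, Finset.mul_sum, ← Finset.sum_add_distrib]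
    exact Finset.sum_congr rfl fun a _ ↦ Finset.sum_congr rfl fun l _ ↦ by ring
  rw [hsplit]
  ring

/-- Freezing an argument costs one extra term, in which that argument itself is differentiated. This
allows formulas for first derivatives to be differentiated again. -/
lemma covDeriv_insert (D : Connection I M) {k : ℕ} (S : TensorField I M (k + 1))
    (Y Z : Π x : M, TangentSpace I x) (X : Fin k → Π x : M, TangentSpace I x) :
    covDeriv D (fun X ↦ S (Fin.cons Y X)) (Fin.cons Z X) x =
      covDeriv D S (Fin.cons Z (Fin.cons Y X)) x + S (Fin.cons (cov D Z Y) X) x := by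
  simp only [covDeriv, Fin.sum_univ_succ, Fin.tail_cons, Fin.cons_zero, Fin.cons_succ,
    Fin.update_cons_zero, ← Fin.cons_update]
  ring

/-- The frozen field is smooth only on V, which is why `IsTensorOn` is relative to a set. -/
lemma IsTensorOn.insert {k : ℕ} {S : TensorField I M (k + 1)} {U V : Set M} (hS : IsTensorOn S U)
    {Y : Π x : M, TangentSpace I x} (hY : ∀ x ∈ V, SmoothNear Y x) (hVU : V ⊆ U) :
    IsTensorOn (fun X ↦ S (Fin.cons Y X)) V where
  smooth hx _ hX := hS.smooth (hVU hx) ((hY _ hx).finCons hX)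
  tensorial {x} hx := by
    obtain ⟨s, hs⟩ := hS.tensorial (hVU hx)
    refine ⟨s.curryLeft (Y x), fun {X} hX ↦ ?_⟩
    rw [hs ((hY _ hx).finCons hX), MultilinearMap.curryLeft_apply]
    congr 1
    ext1 a
    refine Fin.cases ?_ (fun a ↦ ?_) a <;> simp

/-- The derivative of a trace. -/
lemma mvfderiv_trace {B : TensorField I M 2} {U : Set M} (hB : IsTensorOn B U) (hx : x ∈ U)
    (hG : IsOrthonormalFrame g G x) {Y : Π x : M, TangentSpace I x} (hY : SmoothNear Y x) :
    mvfderiv I (fun y ↦ ∑ i, B ![G i, G i] y) x (Y x) =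
      ∑ i, covDeriv (leviCivita g) B ![Y, G i, G i] x := by
  have hs (i) : ∀ a, SmoothNear ((![G i, G i] : Fin 2 → Π x : M, TangentSpace I x) a) x :=
    (hG.smooth i).finCons ((hG.smooth i).finCons fun a ↦ a.elim0)
  obtain ⟨b, hb⟩ := hB.tensorial hx
  rw [mvfderiv_sum fun i _ ↦ hB.smooth hx (hs i)]
  have hexp (i a) : b (Function.update (fun a ↦ (![G i, G i] : Fin 2 → Π x : M, TangentSpace I x) a x)
      a (leviCivita g (G i) x (Y x))) = ∑ l, g.inner x (leviCivita g (G i) x (Y x)) (G l x) *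
        b (Function.update (fun _ ↦ G i x) a (G l x)) := by
    have : (fun a ↦ (![G i, G i] : Fin 2 → Π x : M, TangentSpace I x) a x) = fun _ ↦ G i x := by
      ext1 a
      fin_cases a <;> rfl
    rw [this, hG.cov_eq, MultilinearMap.map_update_sum]
    simp only [MultilinearMap.map_update_smul, smul_eq_mul, ← hG.cov_eq]
  -- Thus the corrections in the two slots are S i l and S l i for one matrix S, and their sum is
  -- annihilated by the skew connection form.
  have hflip (p q : TangentSpace I x) : Function.update (fun _ : Fin 2 ↦ p) 1 q =
      Function.update (fun _ : Fin 2 ↦ q) 0 p := by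
    ext1 a
    fin_cases a <;> rfl
  have hcov (i) : covDeriv (leviCivita g) B ![Y, G i, G i] x =
      mvfderiv I (B ![G i, G i]) x (Y x) - ∑ l, g.inner x (leviCivita g (G i) x (Y x)) (G l x) *
        (b (Function.update (fun _ ↦ G i x) 0 (G l x)) +
          b (Function.update (fun _ ↦ G l x) 0 (G i x))) := by
    refine (covDeriv_apply (preservesSmooth_leviCivita g) hb (hY.finCons (hs i))).trans ?_
    congr 1
    rw [Fin.sum_univ_two]
    refine (congrArg₂ (· + ·) (hexp i 0) (hexp i 1)).trans ?_
    simp only [hflip, mul_add, Finset.sum_add_distrib]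
  simp only [hcov, Finset.sum_sub_distrib]
  rw [eq_comm, sub_eq_self]
  have hzero : ∀ S : Fin (Module.finrank ℝ E) → Fin (Module.finrank ℝ E) → ℝ,
      ∑ i, ∑ l, g.inner x (leviCivita g (G i) x (Y x)) (G l x) * (S i l + S l i) = 0 := by
    intro S
    rw [← self_eq_neg]
    conv_lhs => rw [Finset.sum_comm]
    simp only [← Finset.sum_neg_distrib]
    refine Finset.sum_congr rfl fun i _ ↦ Finset.sum_congr rfl fun l _ ↦ ?_
    rw [hG.skew hY]
    ring
  exact hzero fun i l ↦ b (Function.update (fun _ ↦ G i x) 0 (G l x))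

/-- The bases `onb g x` are chosen pointwise and need not vary smoothly with x, so the norm is
rewritten in a smooth frame before it is differentiated. -/
lemma orthonormalFrame_tensorNormSq {k : ℕ} {T : TensorField I M k} {U : Set M}
    (hT : IsTensorOn T U) (hx : x ∈ U) (hG : IsOrthonormalFrame g G x) :
    tensorNormSq g T x = ∑ i : Fin k → Fin (Module.finrank ℝ E),
      T (fun a ↦ G (i a)) x * T (fun a ↦ G (i a)) x := by
  obtain ⟨t, ht⟩ := hT.tensorial hx
  have h1 (i : Fin k → Fin (Module.finrank ℝ E)) :
      T (fun a ↦ G (i a)) x = t (fun a ↦ G (i a) x) := ht fun a ↦ hG.smooth _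
  have h2 (i : Fin k → Fin (Module.finrank ℝ E)) :
      T (fun a ↦ extend E (onb g x (i a))) x = t (fun a ↦ onb g x (i a)) := by
    rw [ht fun a ↦ smoothNear_extend _]
    simp
  simp only [tensorNormSq, tensorInner, TensorField.val, h1, h2]
  exact (isOrthonormalAt_onb g x).sum_mul_eq hG.orthonormal.self_of_nhds t t

/-! ### The Hessian and the Laplacian of a squared norm. -/

/-- Half of the Hessian of `‖T‖²`. -/
lemma hessian_tensorNormSq {k : ℕ} {T : TensorField I M k} (hT : IsTensorOn T Set.univ)
    {Y : Π x : M, TangentSpace I x} (hY : SmoothNear Y x) :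
    covDeriv (leviCivita g) (covDeriv (leviCivita g)
        (fun _ ↦ tensorNormSq g T : TensorField I M 0)) ![Y, Y] x =
      2 * ∑ i : Fin k → Fin (Module.finrank ℝ E),
        (covDeriv (leviCivita g) (covDeriv (leviCivita g) T)
            (Fin.cons Y (Fin.cons Y fun a ↦ extend E (onb g x (i a)))) x *
          T (fun a ↦ extend E (onb g x (i a))) x +
        covDeriv (leviCivita g) T (Fin.cons Y fun a ↦ extend E (onb g x (i a))) x *
          covDeriv (leviCivita g) T (Fin.cons Y fun a ↦ extend E (onb g x (i a))) x) := by
  obtain ⟨G, hG⟩ := exists_orthonormalFrame g x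
  have hD := preservesSmooth_leviCivita g
  have hT1 := hT.covDeriv g isOpen_univ hD
  have hT2 := hT1.covDeriv g isOpen_univ hD
  let V : Set M := {y | SmoothNear Y y}
  have hS : IsTensorOn (fun X ↦ covDeriv (leviCivita g) T (Fin.cons Y X)) V :=
    hT1.insert (fun _ h ↦ h) (Set.subset_univ _)
  have hTV : IsTensorOn T V := ⟨fun _ ↦ hT.smooth trivial, fun _ ↦ hT.tensorial trivial⟩
  -- The base point y is left free, because this first derivative is differentiated again along Y.
  have hfirst {Z : Π x : M, TangentSpace I x} {y : M} (hZ : SmoothNear Z y)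
      (hG : IsOrthonormalFrame g G y) : mvfderiv I (tensorNormSq g T) y (Z y) =
      2 * ∑ i : Fin k → Fin (Module.finrank ℝ E),
        covDeriv (leviCivita g) T (Fin.cons Z fun a ↦ G (i a)) y * T (fun a ↦ G (i a)) y := by
    rw [mvfderiv_congr (hG.eventually.mono fun y hy ↦
      orthonormalFrame_tensorNormSq hT trivial hy), mvfderiv_inner hT hT trivial hG hZ,
      Finset.mul_sum]
    exact Finset.sum_congr rfl fun i _ ↦ by ring
  have hsmooth (i : Fin k → Fin (Module.finrank ℝ E)) : ∀ a, SmoothNear (G (i a)) x :=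
    fun a ↦ hG.smooth _
  have hframe : covDeriv (leviCivita g) (covDeriv (leviCivita g)
        (fun _ ↦ tensorNormSq g T : TensorField I M 0)) ![Y, Y] x =
      2 * ∑ i : Fin k → Fin (Module.finrank ℝ E),
        (covDeriv (leviCivita g) (covDeriv (leviCivita g) T)
            (Fin.cons Y (Fin.cons Y fun a ↦ G (i a))) x * T (fun a ↦ G (i a)) x +
        covDeriv (leviCivita g) T (Fin.cons Y fun a ↦ G (i a)) x *
          covDeriv (leviCivita g) T (Fin.cons Y fun a ↦ G (i a)) x) := by
    have h1 : covDeriv (leviCivita g) (covDeriv (leviCivita g)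
        (fun _ ↦ tensorNormSq g T : TensorField I M 0)) ![Y, Y] x =
        mvfderiv I (fun y ↦ mvfderiv I (tensorNormSq g T) y (Y y)) x (Y x) -
          mvfderiv I (tensorNormSq g T) x (cov (leviCivita g) Y Y x) := by
      have h0 : covDeriv (leviCivita g) (fun _ ↦ tensorNormSq g T : TensorField I M 0) ![Y] =
          fun y ↦ mvfderiv I (tensorNormSq g T) y (Y y) := by
        ext1 y
        simp [covDeriv]
      rw [← h0]
      simp [covDeriv, Fin.tail]
    rw [h1, hfirst (hD hY hY) hG, mvfderiv_congr (((hY.eventually.and hG.eventually)).mono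
      fun y hy ↦ hfirst hy.1 hy.2), mvfderiv_fun_mul mdifferentiableAt_const
      (SmoothFunNear.sum fun i _ ↦ (hS.smooth hY (hsmooth i)).mul
        (hT.smooth trivial (hsmooth i))).mdiff, _root_.add_apply, _root_.smul_apply,
      mvfderiv_inner hS hTV hY hG hY]
    -- The extra ∇̂_Y Y term of `covDeriv_insert` cancels the term -(∇̂_Y Y)‖T‖² of the Hessian.
    simp only [covDeriv_insert, mvfderiv_const, smul_zero, _root_.zero_apply, add_zero,
      smul_eq_mul, ← mul_sub, ← Finset.sum_sub_distrib]
    congr 1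
    refine Finset.sum_congr rfl fun i _ ↦ ?_
    ring
  rw [hframe]
  obtain ⟨t, ht⟩ := hT.tensorial (Set.mem_univ x)
  obtain ⟨t1, ht1⟩ := hT1.tensorial (Set.mem_univ x)
  obtain ⟨t2, ht2⟩ := hT2.tensorial (Set.mem_univ x)
  -- Both sums are scalar products of multilinear forms at x, so the smooth frame may be exchanged
  -- for `onb g x`.
  have key {F : Fin (Module.finrank ℝ E) → Π x : M, TangentSpace I x}
      (hF : ∀ i, SmoothNear (F i) x) : ∑ i : Fin k → Fin (Module.finrank ℝ E),
        (covDeriv (leviCivita g) (covDeriv (leviCivita g) T)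
            (Fin.cons Y (Fin.cons Y fun a ↦ F (i a))) x * T (fun a ↦ F (i a)) x +
        covDeriv (leviCivita g) T (Fin.cons Y fun a ↦ F (i a)) x *
          covDeriv (leviCivita g) T (Fin.cons Y fun a ↦ F (i a)) x) =
      ∑ i : Fin k → Fin (Module.finrank ℝ E),
        (t2.curryLeft (Y x)).curryLeft (Y x) (fun a ↦ F (i a) x) * t (fun a ↦ F (i a) x) +
      ∑ i : Fin k → Fin (Module.finrank ℝ E),
        t1.curryLeft (Y x) (fun a ↦ F (i a) x) * t1.curryLeft (Y x) (fun a ↦ F (i a) x) := by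
    rw [← Finset.sum_add_distrib]
    refine Finset.sum_congr rfl fun i _ ↦ ?_
    have hs : ∀ a, SmoothNear (F (i a)) x := fun a ↦ hF _
    have e1 (v w : Π x : M, TangentSpace I x) :
        (fun a ↦ (Fin.cons v (fun a ↦ F (i a)) : Fin (k + 1) → Π x : M, TangentSpace I x) a x) =
        Fin.cons (v x) fun a ↦ F (i a) x := by
      ext1 a
      refine Fin.cases ?_ (fun a ↦ ?_) a <;> simp
    have e2 (v w : Π x : M, TangentSpace I x) : (fun a ↦ (Fin.cons v (Fin.cons w fun a ↦ F (i a)) :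
          Fin (k + 2) → Π x : M, TangentSpace I x) a x) =
        Fin.cons (v x) (Fin.cons (w x) fun a ↦ F (i a) x) := by
      ext1 a
      refine Fin.cases ?_ (fun a ↦ ?_) a
      · simp
      · exact congrFun (e1 w w) a
    rw [ht hs, ht1 (hY.finCons hs), ht2 (hY.finCons (hY.finCons hs)), e2, e1 Y Y]
    rfl
  rw [key hG.smooth, key fun i ↦ smoothNear_extend _]
  simp only [extend_apply_self]
  rw [hG.orthonormal.self_of_nhds.sum_mul_eq (isOrthonormalAt_onb g x),
    hG.orthonormal.self_of_nhds.sum_mul_eq (isOrthonormalAt_onb g x)]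

lemma sum_finCons {n k : ℕ} (f : (Fin (k + 1) → Fin n) → ℝ) :
    ∑ i, f i = ∑ j, ∑ i : Fin k → Fin n, f (Fin.cons j i) := by
  rw [← (Fin.consEquiv fun _ ↦ Fin n).sum_comp, Fintype.sum_prod_type]
  rfl

/-- The Bochner formula `½ Δ‖T‖² = ‖∇̂T‖² + g(ΔT, T)`. -/
lemma laplacianFun_tensorNormSq {k : ℕ} {T : TensorField I M k} (hT : IsTensorOn T Set.univ) :
    1 / 2 * laplacianFun g (tensorNormSq g T) x =
      tensorNormSq g (covDeriv (leviCivita g) T) x + tensorInner g (laplacian g T) T x := by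
  have h1 : laplacianFun g (tensorNormSq g T) x = ∑ l, covDeriv (leviCivita g)
      (covDeriv (leviCivita g) (fun _ ↦ tensorNormSq g T : TensorField I M 0))
      ![extend E (onb g x l), extend E (onb g x l)] x := by
    unfold laplacianFun laplacian
    refine Finset.sum_congr rfl fun l _ ↦ ?_
    congr 2
  rw [h1]
  simp only [hessian_tensorNormSq hT (smoothNear_extend _), ← Finset.mul_sum,
    Finset.sum_add_distrib]
  have h2 (a b : ℝ) : 1 / 2 * (2 * (a + b)) = b + a := by ring
  rw [h2]
  congr 1
  · simp only [tensorNormSq, tensorInner, sum_finCons (k := k), TensorField.val]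
    refine Finset.sum_congr rfl fun l _ ↦ Finset.sum_congr rfl fun i _ ↦ ?_
    have : (fun a ↦ extend E (onb g x ((Fin.cons l i : Fin (k + 1) → _) a)) :
        Fin (k + 1) → Π x : M, TangentSpace I x) =
        Fin.cons (extend E (onb g x l)) fun a ↦ extend E (onb g x (i a)) := by
      ext1 a
      refine Fin.cases ?_ (fun a ↦ ?_) a <;> simp
    rw [this]
  · simp only [tensorInner, TensorField.val, laplacian, Finset.sum_mul]
    rw [Finset.sum_comm]

end

/-! ### The difference tensor and the cubic form -/

section

/-- The difference tensor as a bilinear map; `diffHom g D x v u` is `K(u, v)`. -/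
def diffHom (g : SmoothMetric I M) (D : Connection I M) (x : M) :
    TangentSpace I x →L[ℝ] TangentSpace I x →L[ℝ] TangentSpace I x :=
  D.isCovariantDerivativeOn.difference (s := Set.univ)
    (leviCivita g).isCovariantDerivativeOn x

variable {g : SmoothMetric I M} {D : Connection I M} {X Y Z W V : Π x : M, TangentSpace I x}

lemma diffTensor_apply (hY : SmoothNear Y x) :
    diffTensor g D X Y x = diffHom g D x (Y x) (X x) := by
  rw [diffHom, IsCovariantDerivativeOn.difference_apply (hx := Set.mem_univ x) _ _ hY.mdiff]
  rfl

lemma SmoothNear.diffTensor (hD : PreservesSmooth D) (hX : SmoothNear X x) (hY : SmoothNear Y x) :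
    SmoothNear (diffTensor g D X Y) x :=
  (hD hX hY).sub (preservesSmooth_leviCivita g hX hY)

lemma cubicForm_apply (hY : SmoothNear Y x) :
    cubicForm g D ![X, Y, Z] x = g.inner x (diffHom g D x (Y x) (X x)) (Z x) := by
  rw [← diffTensor_apply hY]
  rfl

lemma SmoothNear.vec₂ (hX : SmoothNear X x) (hY : SmoothNear Y x) :
    ∀ a, SmoothNear ((![X, Y] : Fin 2 → Π x : M, TangentSpace I x) a) x :=
  hX.finCons (hY.finCons fun a ↦ a.elim0)

lemma SmoothNear.vec₃ (hX : SmoothNear X x) (hY : SmoothNear Y x) (hZ : SmoothNear Z x) :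
    ∀ a, SmoothNear ((![X, Y, Z] : Fin 3 → Π x : M, TangentSpace I x) a) x :=
  hX.finCons (hY.vec₂ hZ)

lemma SmoothNear.vec₄ (hX : SmoothNear X x) (hY : SmoothNear Y x) (hZ : SmoothNear Z x)
    (hW : SmoothNear W x) :
    ∀ a, SmoothNear ((![X, Y, Z, W] : Fin 4 → Π x : M, TangentSpace I x) a) x :=
  hX.finCons (hY.vec₃ hZ hW)

lemma isTensorOn_cubicForm (hD : PreservesSmooth D) : IsTensorOn (cubicForm g D) Set.univ where
  smooth _ X hX := ((hX 0).diffTensor hD (hX 1)).metric g (hX 2)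
  tensorial {x} _ := by
    let κ := diffHom g D x
    refine ⟨⟨fun v ↦ g.inner x (diffHom g D x (v 1) (v 0)) (v 2), ?_, ?_⟩, fun {X} hX ↦ ?_⟩
    · intro inst v a p q
      rw [Subsingleton.elim inst (instDecidableEqFin 3)]
      match a with
      | 0 =>
        change g.inner x (κ (v 1) (p + q)) (v 2) =
          g.inner x (κ (v 1) p) (v 2) + g.inner x (κ (v 1) q) (v 2)
        simp only [map_add, _root_.add_apply]
      | 1 =>
        change g.inner x (κ (p + q) (v 0)) (v 2) =
          g.inner x (κ p (v 0)) (v 2) + g.inner x (κ q (v 0)) (v 2)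
        simp only [map_add, _root_.add_apply]
      | 2 => exact map_add (g.inner x (κ (v 1) (v 0))) p q
    · intro inst v a c p
      rw [Subsingleton.elim inst (instDecidableEqFin 3)]
      match a with
      | 0 =>
        change g.inner x (κ (v 1) (c • p)) (v 2) = c • g.inner x (κ (v 1) p) (v 2)
        simp only [map_smul, _root_.smul_apply]
      | 1 =>
        change g.inner x (κ (c • p) (v 0)) (v 2) = c • g.inner x (κ p (v 0)) (v 2)
        simp only [map_smul, _root_.smul_apply]
      | 2 => exact map_smul (g.inner x (κ (v 1) (v 0))) c p
    · change g.inner x (diffTensor g D (X 0) (X 1) x) (X 2 x) = _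
      rw [diffTensor_apply (hX 1)]
      rfl

lemma covDeriv_two (B : TensorField I M 2) :
    covDeriv D B ![X, Y, Z] x = mvfderiv I (B ![Y, Z]) x (X x)
      - (B ![cov D X Y, Z] x + B ![Y, cov D X Z] x) := by
  rw [covDeriv, Fin.sum_univ_two]
  congr 3
  · ext1 a; fin_cases a <;> rfl
  · ext1 a; fin_cases a <;> rfl

lemma covDeriv_three (B : TensorField I M 3) :
    covDeriv D B ![X, Y, Z, W] x = mvfderiv I (B ![Y, Z, W]) x (X x)
      - (B ![cov D X Y, Z, W] x + B ![Y, cov D X Z, W] x + B ![Y, Z, cov D X W] x) := by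
  rw [covDeriv, Fin.sum_univ_three]
  congr 4
  · ext1 a; fin_cases a <;> rfl
  · ext1 a; fin_cases a <;> rfl
  · ext1 a; fin_cases a <;> rfl

lemma covDeriv_four (B : TensorField I M 4) :
    covDeriv D B ![X, Y, Z, W, V] x = mvfderiv I (B ![Y, Z, W, V]) x (X x)
      - (B ![cov D X Y, Z, W, V] x + B ![Y, cov D X Z, W, V] x + B ![Y, Z, cov D X W, V] x
        + B ![Y, Z, W, cov D X V] x) := by
  rw [covDeriv, Fin.sum_univ_four]
  congr 5
  · ext1 a; fin_cases a <;> rfl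
  · ext1 a; fin_cases a <;> rfl
  · ext1 a; fin_cases a <;> rfl
  · ext1 a; fin_cases a <;> rfl

lemma mlieBracket_eq_leviCivita_sub (hX : SmoothNear X x) (hY : SmoothNear Y x) :
    mlieBracket I X Y x = leviCivita g Y x (X x) - leviCivita g X x (Y x) :=
  ((CovariantDerivative.torsion_eq_zero_iff _).mp (leviCivita_torsion g) hX.mdiff hY.mdiff).symm

/-- Both connections are torsion-free, so their antisymmetric parts are the same bracket and cancel
in the difference. -/
lemma diffHom_comm (hD : D.torsion = 0) (u v : TangentSpace I x) :
    diffHom g D x v u = diffHom g D x u v := by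
  have hu : SmoothNear (extend E u) x := smoothNear_extend u
  have hv : SmoothNear (extend E v) x := smoothNear_extend v
  have h1 := (CovariantDerivative.torsion_eq_zero_iff _).mp hD hu.mdiff hv.mdiff
  rw [mlieBracket_eq_leviCivita_sub (g := g) hu hv] at h1
  have h2 := diffTensor_apply (g := g) (D := D) (X := extend E u) hv
  have h3 := diffTensor_apply (g := g) (D := D) (X := extend E v) hu
  simp only [diffTensor, extend_apply_self] at h1 h2 h3
  rw [← h2, ← h3]
  exact sub_eq_sub_iff_sub_eq_sub.mpr h1

/-- Since ∇̂g = 0, only the action of K on the two slots of g survives. -/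
lemma covDeriv_metricTensor (hX : SmoothNear X x) (hY : SmoothNear Y x) (hZ : SmoothNear Z x) :
    covDeriv D (metricTensor g) ![X, Y, Z] x =
      -(cubicForm g D ![X, Y, Z] x + cubicForm g D ![X, Z, Y] x) := by
  have h := leviCivita_metric g hX.mdiff hY.mdiff hZ.mdiff
  rw [covDeriv_two]
  change mvfderiv I (fun y ↦ g.inner y (Y y) (Z y)) x (X x)
    - (g.inner x (D Y x (X x)) (Z x) + g.inner x (Y x) (D Z x (X x))) =
    -(g.inner x (D Y x (X x) - leviCivita g Y x (X x)) (Z x) +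
      g.inner x (D Z x (X x) - leviCivita g Z x (X x)) (Y x))
  rw [h]
  simp only [map_sub, _root_.sub_apply, g.symm x (Y x)]
  ring

/-- ∇g(u, v, w) = -(A(u, v, w) + A(u, w, v)) is symmetric in u, v, and so is its first summand by
torsion-freeness. Hence A(u, w, v) = A(v, w, u), and A is totally symmetric: each K_u is
self-adjoint. -/
lemma inner_diffHom_comm (h : IsStatistical g D) (u v w : TangentSpace I x) :
    g.inner x (diffHom g D x v u) w = g.inner x (diffHom g D x w u) v := by
  have hs (u : TangentSpace I x) : SmoothNear (extend E u) x := smoothNear_extend u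
  have hval (u v w : TangentSpace I x) : (covDeriv D (metricTensor g)).val x ![u, v, w] =
      -(g.inner x (diffHom g D x v u) w + g.inner x (diffHom g D x w u) v) := by
    have : (fun a ↦ extend E ((![u, v, w] : Fin 3 → TangentSpace I x) a)) =
        ![extend E u, extend E v, extend E w] := by
      ext1 a
      fin_cases a <;> rfl
    rw [TensorField.val, this, covDeriv_metricTensor (hs u) (hs v) (hs w), cubicForm_apply (hs v),
      cubicForm_apply (hs w)]
    simp only [extend_apply_self]
  have hswap (u v w : TangentSpace I x) := h.symmetric x ![u, v, w] (Equiv.swap 0 1)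
  have hperm (u v w : TangentSpace I x) :
      (![u, v, w] ∘ Equiv.swap 0 1 : Fin 3 → TangentSpace I x) = ![v, u, w] := by
    ext1 a
    fin_cases a <;> rfl
  simp only [hperm, hval] at hswap
  have h1 := hswap u v w
  have h2 := hswap v w u
  have h3 := hswap w u v
  rw [diffHom_comm h.torsion_free v u] at h1
  simp only [diffHom_comm h.torsion_free w u, diffHom_comm h.torsion_free w v,
    diffHom_comm h.torsion_free v u] at *
  linarith

lemma cubicForm_swap₁₂ (h : IsStatistical g D) (hX : SmoothNear X x) (hY : SmoothNear Y x) :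
    cubicForm g D ![X, Y, Z] x = cubicForm g D ![Y, X, Z] x := by
  rw [cubicForm_apply hY, cubicForm_apply hX, diffHom_comm h.torsion_free]

lemma cubicForm_swap₂₃ (h : IsStatistical g D) (hY : SmoothNear Y x) (hZ : SmoothNear Z x) :
    cubicForm g D ![X, Y, Z] x = cubicForm g D ![X, Z, Y] x := by
  rw [cubicForm_apply hY, cubicForm_apply hZ, inner_diffHom_comm h]

/-- The covariant derivative inherits symmetries in the remaining arguments. -/
lemma covDeriv_comp_perm {k : ℕ} {T : TensorField I M k} (hD : PreservesSmooth D)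
    (σ : Equiv.Perm (Fin k))
    (hT : ∀ (y : M) (X : Fin k → Π x : M, TangentSpace I x), (∀ a, SmoothNear (X a) y) →
      T (X ∘ σ) y = T X y) (hY : SmoothNear Y x) {X : Fin k → Π x : M, TangentSpace I x}
    (hX : ∀ a, SmoothNear (X a) x) :
    covDeriv D T (Fin.cons Y (X ∘ σ)) x = covDeriv D T (Fin.cons Y X) x := by
  simp only [covDeriv, Fin.tail_cons, Fin.cons_zero]
  rw [mvfderiv_congr ((eventually_all.mpr fun a ↦ (hX a).eventually).mono fun y hy ↦ hT y X hy)]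
  congr 1
  -- Differentiating slot a of X ∘ σ is differentiating slot σ a of X, so the correction terms are
  -- merely permuted.
  refine (Finset.sum_congr rfl fun a _ ↦ ?_).trans
    (Equiv.sum_comp σ fun a ↦ T (Function.update X a (cov D Y (X a))) x)
  have h := hT x (Function.update X (σ a) (cov D Y (X (σ a))))
    (SmoothNear.update hX (hD hY (hX _)))
  refine Eq.trans ?_ h
  congr 1
  ext1 b
  by_cases hb : b = a
  · subst hb; simp
  · simp [hb]

lemma cov_eq_add (X Y : Π x : M, TangentSpace I x) :
    cov D X Y = cov (leviCivita g) X Y + diffTensor g D X Y := by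
  ext1 y
  simp [diffTensor]

/-- The covariant derivative of the cubic form in terms of that of the difference tensor. -/
lemma covDeriv_cubicForm (hD : PreservesSmooth D) (hX : SmoothNear X x) (hY : SmoothNear Y x)
    (hZ : SmoothNear Z x) (hW : SmoothNear W x) :
    covDeriv (leviCivita g) (cubicForm g D) ![X, Y, Z, W] x =
      g.inner x (leviCivita g (diffTensor g D Y Z) x (X x)
        - diffHom g D x (Z x) (leviCivita g Y x (X x))
        - diffHom g D x (leviCivita g Z x (X x)) (Y x)) (W x) := by
  have hLC := preservesSmooth_leviCivita g
  rw [covDeriv_three, cubicForm_apply hZ, cubicForm_apply (hLC hX hZ), cubicForm_apply hZ]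
  have h := leviCivita_metric g hX.mdiff (hY.diffTensor (g := g) hD hZ).mdiff hW.mdiff
  change mvfderiv I (fun y ↦ g.inner y (diffTensor g D Y Z y) (W y)) x (X x) - _ = _
  rw [h, diffTensor_apply hZ]
  simp only [map_sub, _root_.sub_apply]
  ring

/-! ### Curvature, the Codazzi equation and the Ricci identity. -/

/-- The curvature of `∇ = ∇̂ + K`. -/
lemma curvature_eq (hD : PreservesSmooth D) (hX : SmoothNear X x)
    (hY : SmoothNear Y x) (hZ : SmoothNear Z x) (hW : SmoothNear W x) :
    g.inner x (curvature D X Y Z x) (W x) =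
      g.inner x (curvature (leviCivita g) X Y Z x) (W x)
      + (covDeriv (leviCivita g) (cubicForm g D) ![X, Y, Z, W] x
        - covDeriv (leviCivita g) (cubicForm g D) ![Y, X, Z, W] x)
      + g.inner x (bracketKK g D X Y Z x) (W x) := by
  have hLC := preservesSmooth_leviCivita g
  have hDD {X Y : Π x : M, TangentSpace I x} (hX : SmoothNear X x) (hY : SmoothNear Y x) :
      D (cov D Y Z) x (X x) = leviCivita g (cov (leviCivita g) Y Z) x (X x)
        + diffHom g D x (leviCivita g Z x (Y x)) (X x)
        + leviCivita g (diffTensor g D Y Z) x (X x) + diffTensor g D X (diffTensor g D Y Z) x := by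
    rw [cov_eq_add (g := g) Y Z, D.isCovariantDerivativeOnUniv.add (hLC hY hZ).mdiff
      (hY.diffTensor hD hZ).mdiff, ← diffTensor_apply (hLC hY hZ)]
    simp only [diffTensor, _root_.add_apply]
    abel
  -- Torsion-freeness of ∇̂ splits K([X, Y], Z) into the two terms that complete the derivatives of
  -- K to ∇̂K.
  have hbr : D Z x (mlieBracket I X Y x) = leviCivita g Z x (mlieBracket I X Y x)
      + diffHom g D x (Z x) (leviCivita g Y x (X x))
      - diffHom g D x (Z x) (leviCivita g X x (Y x)) := by
    rw [add_sub_assoc, ← map_sub, ← mlieBracket_eq_leviCivita_sub hX hY, ← diffTensor_apply hZ]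
    simp only [diffTensor]
    abel
  have hc (D : Connection I M) : curvature D X Y Z x =
    D (cov D Y Z) x (X x) - D (cov D X Z) x (Y x) - D Z x (mlieBracket I X Y x) := rfl
  rw [covDeriv_cubicForm hD hX hY hZ hW, covDeriv_cubicForm hD hY hX hZ hW, hc, hc, hDD hX hY,
    hDD hY hX, hbr, bracketKK]
  simp only [map_sub, map_add, _root_.sub_apply, _root_.add_apply, Pi.sub_apply]
  ring

lemma curvature_swap (D : Connection I M) (X Y Z : Π x : M, TangentSpace I x) :
    curvature D Y X Z x = -curvature D X Y Z x := by
  simp only [curvature, mlieBracket_swap_apply (V := Y) (W := X), map_neg]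
  abel

/-- The second derivatives of a function commute up to the bracket. -/
lemma mvfderiv_mvfderiv_sub (g : SmoothMetric I M) {f : M → ℝ} (hf : SmoothFunNear I f x)
    (hX : SmoothNear X x) (hY : SmoothNear Y x) :
    mvfderiv I (fun y ↦ mvfderiv I f y (Y y)) x (X x) -
      mvfderiv I (fun y ↦ mvfderiv I f y (X y)) x (Y x) = mvfderiv I f x (mlieBracket I X Y x) :=
  (mvfderiv_mlieBracket hX hY hf (hf.mvfderiv g hX).mdiff (hf.mvfderiv g hY).mdiff).symm

/-- The operator XY - YX - [X, Y] annihilates the function g(Z, W). Expanding by metric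
compatibility, the mixed terms are symmetric in X, Y and cancel, leaving g(R̂(X, Y)Z, W) + g(Z,
R̂(X, Y)W) = 0. -/
lemma curvature_leviCivita_skew (hX : SmoothNear X x) (hY : SmoothNear Y x) (hZ : SmoothNear Z x)
    (hW : SmoothNear W x) :
    g.inner x (curvature (leviCivita g) X Y Z x) (W x) =
      -g.inner x (curvature (leviCivita g) X Y W x) (Z x) := by
  have hLC := preservesSmooth_leviCivita g
  have hXY {X Y : Π x : M, TangentSpace I x} (hX : SmoothNear X x) (hY : SmoothNear Y x) :
      mvfderiv I (fun y ↦ mvfderiv I (fun y ↦ g.inner y (Z y) (W y)) y (Y y)) x (X x) =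
      g.inner x (leviCivita g (cov (leviCivita g) Y Z) x (X x)) (W x)
      + g.inner x (leviCivita g Z x (Y x)) (leviCivita g W x (X x))
      + (g.inner x (leviCivita g Z x (X x)) (leviCivita g W x (Y x))
      + g.inner x (leviCivita g (cov (leviCivita g) Y W) x (X x)) (Z x)) := by
    rw [mvfderiv_congr (f' := fun y ↦ g.inner y (cov (leviCivita g) Y Z y) (W y) +
      g.inner y (Z y) (cov (leviCivita g) Y W y)),
      mvfderiv_fun_add ((hLC hY hZ).metric g hW).mdiff (hZ.metric g (hLC hY hW)).mdiff,
      _root_.add_apply, leviCivita_metric g hX.mdiff (hLC hY hZ).mdiff hW.mdiff,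
      leviCivita_metric g hX.mdiff hZ.mdiff (hLC hY hW).mdiff,
      g.symm x (Z x) (leviCivita g (cov (leviCivita g) Y W) x (X x))]
    filter_upwards [hY.eventually, hZ.eventually, hW.eventually] with y hy hz hw
    exact leviCivita_metric g hy.mdiff hz.mdiff hw.mdiff
  have h1 := mvfderiv_mvfderiv_sub g (hZ.metric g hW) hX hY
  rw [hXY hX hY, hXY hY hX, leviCivita_metric g (hX.mlieBracket hY).mdiff hZ.mdiff hW.mdiff,
    g.symm x (Z x)] at h1
  have hc (Z : Π x : M, TangentSpace I x) : curvature (leviCivita g) X Y Z x =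
    leviCivita g (cov (leviCivita g) Y Z) x (X x) - leviCivita g (cov (leviCivita g) X Z) x (Y x)
      - leviCivita g Z x (mlieBracket I X Y x) := rfl
  simp only [hc, map_sub, _root_.sub_apply]
  linarith

/-- K_X and K_Y are self-adjoint. In this form skewness in Z and W is visible. -/
lemma inner_bracketKK (h : IsStatistical g D) (hD : PreservesSmooth D) (hX : SmoothNear X x)
    (hY : SmoothNear Y x) (hZ : SmoothNear Z x) :
    g.inner x (bracketKK g D X Y Z x) (W x) =
      g.inner x (diffHom g D x (W x) (X x)) (diffHom g D x (Z x) (Y x))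
      - g.inner x (diffHom g D x (W x) (Y x)) (diffHom g D x (Z x) (X x)) := by
  rw [bracketKK, Pi.sub_apply, diffTensor_apply (hY.diffTensor hD hZ),
    diffTensor_apply (hX.diffTensor hD hZ), diffTensor_apply hZ, diffTensor_apply hZ, map_sub,
    _root_.sub_apply, inner_diffHom_comm h, inner_diffHom_comm h _ _ (W x)]

/-- The Codazzi equation: for a conjugate symmetric structure, `∇̂A` is totally symmetric. -/
lemma codazzi (h : IsStatistical g D) (hconj : IsConjugateSymmetric g D) (hD : PreservesSmooth D)
    (hX : SmoothNear X x) (hY : SmoothNear Y x) (hZ : SmoothNear Z x) (hW : SmoothNear W x) :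
    covDeriv (leviCivita g) (cubicForm g D) ![X, Y, Z, W] x =
      covDeriv (leviCivita g) (cubicForm g D) ![Y, X, Z, W] x := by
  have hLC := preservesSmooth_leviCivita g
  have hA := (isTensorOn_cubicForm (g := g) hD).covDeriv g isOpen_univ hLC
  have hs (u : TangentSpace I x) : SmoothNear (extend E u) x := smoothNear_extend u
  have hext {X Y Z W : Π x : M, TangentSpace I x} (hX : SmoothNear X x) (hY : SmoothNear Y x)
      (hZ : SmoothNear Z x) (hW : SmoothNear W x) :
      covDeriv (leviCivita g) (cubicForm g D) ![X, Y, Z, W] x =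
      covDeriv (leviCivita g) (cubicForm g D)
        ![extend E (X x), extend E (Y x), extend E (Z x), extend E (W x)] x := by
    refine hA.eq_of_eq trivial (hX.vec₄ hY hZ hW) ((hs _).vec₄ (hs _) (hs _) (hs _)) fun a ↦ ?_
    match a with
    | 0 => exact (extend_apply_self E (X x)).symm
    | 1 => exact (extend_apply_self E (Y x)).symm
    | 2 => exact (extend_apply_self E (Z x)).symm
    | 3 => exact (extend_apply_self E (W x)).symm
  rw [hext hX hY hZ hW, hext hY hX hZ hW]
  have hval (u v w z : TangentSpace I x) : (riem g D).val x ![u, v, w, z] =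
      g.inner x (curvature D (extend E u) (extend E v) (extend E w) x) (extend E z x) := rfl
  -- The R̂ and [K, K] parts are skew in Z, W and cancel here. The ∇̂A part is symmetric by `hswap`,
  -- so twice the difference to be shown zero remains.
  have h1 := hconj x (X x) (Y x) (Z x) (W x)
  rw [hval, hval, curvature_eq hD (hs _) (hs _) (hs _) (hs _),
    curvature_eq hD (hs _) (hs _) (hs _) (hs _), inner_bracketKK h hD (hs _) (hs _) (hs _),
    inner_bracketKK h hD (hs _) (hs _) (hs _),
    curvature_leviCivita_skew (hs _) (hs _) (hs (Z x)) (hs (W x))] at h1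
  have hswap (u v w z : TangentSpace I x) : covDeriv (leviCivita g) (cubicForm g D)
      ![extend E u, extend E v, extend E w, extend E z] x = covDeriv (leviCivita g) (cubicForm g D)
      ![extend E u, extend E v, extend E z, extend E w] x := by
    refine Eq.trans ?_ (covDeriv_comp_perm hLC (Equiv.swap 1 2) (fun y X hX ↦ ?_) (hs u)
      ((hs v).vec₃ (hs z) (hs w)))
    · congr 2
      ext1 a
      fin_cases a <;> rfl
    · have e1 : X ∘ Equiv.swap 1 2 = ![X 0, X 2, X 1] := by
        ext1 a
        fin_cases a <;> rfl
      have e2 : X = ![X 0, X 1, X 2] := by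
        ext1 a
        fin_cases a <;> rfl
      rw [e1, cubicForm_swap₂₃ h (hX 2) (hX 1), ← e2]
  rw [hswap (X x) (Y x) (W x), hswap (Y x) (X x) (W x)] at h1
  rw [g.symm x (diffHom g D x _ _) (diffHom g D x (extend E (W x) x) _),
    g.symm x (diffHom g D x _ _) (diffHom g D x (extend E (W x) x) _)] at h1
  linarith

/-- The Ricci identity for the cubic form. -/
lemma ricci_identity (hD : PreservesSmooth D) (hX : SmoothNear X x) (hY : SmoothNear Y x)
    (hZ : SmoothNear Z x) (hW : SmoothNear W x) (hV : SmoothNear V x) :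
    covDeriv (leviCivita g) (covDeriv (leviCivita g) (cubicForm g D)) ![X, Y, Z, W, V] x =
      covDeriv (leviCivita g) (covDeriv (leviCivita g) (cubicForm g D)) ![Y, X, Z, W, V] x
      - (g.inner x (diffHom g D x (W x) (curvature (leviCivita g) X Y Z x)) (V x)
        + g.inner x (diffHom g D x (curvature (leviCivita g) X Y W x) (Z x)) (V x)
        + g.inner x (diffHom g D x (W x) (Z x)) (curvature (leviCivita g) X Y V x)) := by
  have hLC := preservesSmooth_leviCivita g
  have hA := isTensorOn_cubicForm (g := g) hD
  have hs {Z W V : Π x : M, TangentSpace I x} (hZ : SmoothNear Z x) (hW : SmoothNear W x)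
      (hV : SmoothNear V x) : SmoothFunNear I (cubicForm g D ![Z, W, V]) x :=
    hA.smooth trivial (hZ.vec₃ hW hV)
  have hYd {Y : Π x : M, TangentSpace I x} (hY : SmoothNear Y x) (v : TangentSpace I x) :
      mvfderiv I (covDeriv (leviCivita g) (cubicForm g D) ![Y, Z, W, V]) x v =
      mvfderiv I (fun y ↦ mvfderiv I (cubicForm g D ![Z, W, V]) y (Y y)) x v
      - (mvfderiv I (cubicForm g D ![cov (leviCivita g) Y Z, W, V]) x v
        + mvfderiv I (cubicForm g D ![Z, cov (leviCivita g) Y W, V]) x v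
        + mvfderiv I (cubicForm g D ![Z, W, cov (leviCivita g) Y V]) x v) := by
    have e : covDeriv (leviCivita g) (cubicForm g D) ![Y, Z, W, V] = fun y ↦
        mvfderiv I (cubicForm g D ![Z, W, V]) y (Y y)
        - (cubicForm g D ![cov (leviCivita g) Y Z, W, V] y
          + cubicForm g D ![Z, cov (leviCivita g) Y W, V] y
          + cubicForm g D ![Z, W, cov (leviCivita g) Y V] y) := by
      ext1 y
      exact covDeriv_three _
    have h1 := hs (hLC hY hZ) hW hV
    have h2 := hs hZ (hLC hY hW) hV
    have h3 := hs hZ hW (hLC hY hV)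
    rw [e, mvfderiv_fun_sub ((hs hZ hW hV).mvfderiv g hY).mdiff ((h1.add h2).add h3).mdiff,
      mvfderiv_fun_add (h1.add h2).mdiff h3.mdiff, mvfderiv_fun_add h1.mdiff h2.mdiff]
    rfl
  -- On the function A(Z, W, V) the second derivatives commute up to the bracket; the second
  -- derivatives of each argument assemble into R̂, and all mixed terms cancel.
  have hbr := mvfderiv_mvfderiv_sub g (hs hZ hW hV) hX hY
  have hc (Z : Π x : M, TangentSpace I x) : curvature (leviCivita g) X Y Z x =
    leviCivita g (cov (leviCivita g) Y Z) x (X x) - leviCivita g (cov (leviCivita g) X Z) x (Y x)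
      - leviCivita g Z x (mlieBracket I X Y x) := rfl
  rw [covDeriv_four, covDeriv_four, hYd hX, hYd hY]
  simp only [covDeriv_three]
  simp only [cubicForm_apply, hW, hLC hX hW, hLC hY hW, hLC hX (hLC hY hW),
    hLC hY (hLC hX hW), hLC (hLC hX hY) hW, hLC (hLC hY hX) hW]
  rw [mlieBracket_eq_leviCivita_sub (g := g) hX hY] at hbr
  simp only [hc, mlieBracket_eq_leviCivita_sub (g := g) hX hY, map_sub, _root_.sub_apply] at hbr ⊢
  linarith

/-! ### Traces of the cubic form and its rough Laplacian. -/

/-- The trace of a bilinear form does not depend on the orthonormal basis. -/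
lemma IsOrthonormalAt.trace_eq {e f : Fin (Module.finrank ℝ E) → TangentSpace I x}
    (he : IsOrthonormalAt g x e) (hf : IsOrthonormalAt g x f)
    (b : TangentSpace I x →ₗ[ℝ] TangentSpace I x →ₗ[ℝ] ℝ) :
    ∑ i, b (e i) (e i) = ∑ i, b (f i) (f i) := by
  have h1 (i) : b (e i) (e i) = ∑ r, b (f r) (g.inner x (f r) (e i) • e i) := by
    have h2 := congrArg (fun v ↦ b v (e i)) (hf.sum_smul (e i))
    simp only [map_sum, map_smul, LinearMap.sum_apply, LinearMap.smul_apply] at h2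
    simp only [← h2, map_smul, g.symm x (f _)]
  simp only [h1]
  rw [Finset.sum_comm]
  simp only [← map_sum, he.sum_smul]

variable {G : Fin (Module.finrank ℝ E) → Π x : M, TangentSpace I x}

/-- As for the norm, a smooth frame replaces the pointwise bases so that τ can be differentiated. -/
lemma czebyshev_eq_sum (hG : IsOrthonormalFrame g G x) (X : Π x : M, TangentSpace I x) :
    czebyshev g D ![X] x = ∑ i, cubicForm g D ![X, G i, G i] x := by
  let b : TangentSpace I x →ₗ[ℝ] TangentSpace I x →ₗ[ℝ] ℝ :=
    LinearMap.mk₂ ℝ (fun v w ↦ g.inner x (diffHom g D x v (X x)) w) (by simp) (by simp) (by simp)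
      (by simp)
  have h := (isOrthonormalAt_onb g x).trace_eq hG.orthonormal.self_of_nhds b
  simp only [czebyshev, cubicForm_apply (hG.smooth _)]
  refine Eq.trans (Finset.sum_congr rfl fun i _ ↦ ?_) h
  exact (cubicForm_apply (smoothNear_extend _)).trans (by simp [b])

/-- `∇̂τ` is the trace of `∇̂A`. -/
lemma covDeriv_czebyshev (hD : PreservesSmooth D) (hG : IsOrthonormalFrame g G x)
    (hX : SmoothNear X x) (hY : SmoothNear Y x) :
    covDeriv (leviCivita g) (czebyshev g D) ![X, Y] x =
      ∑ i, covDeriv (leviCivita g) (cubicForm g D) ![X, Y, G i, G i] x := by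
  have h1 : covDeriv (leviCivita g) (czebyshev g D) ![X, Y] x =
      mvfderiv I (czebyshev g D ![Y]) x (X x)
        - czebyshev g D ![cov (leviCivita g) X Y] x := by
    rw [covDeriv, Fin.sum_univ_one]
    congr 3
    ext1 a
    fin_cases a
    rfl
  have hB : IsTensorOn (fun W ↦ cubicForm g D (Fin.cons Y W)) {y | SmoothNear Y y} :=
    (isTensorOn_cubicForm hD).insert (fun _ h ↦ h) (Set.subset_univ _)
  rw [h1, mvfderiv_congr (hG.eventually.mono fun y hy ↦ czebyshev_eq_sum (D := D) hy Y),
    czebyshev_eq_sum hG, sub_eq_iff_eq_add, ← Finset.sum_add_distrib]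
  refine (mvfderiv_trace hB hY hG hX).trans (Finset.sum_congr rfl fun i _ ↦ ?_)
  exact covDeriv_insert _ _ _ _ _

/-- `∇̂²τ` is the trace of `∇̂²A`. -/
lemma covDeriv_covDeriv_czebyshev (hD : PreservesSmooth D) (hG : IsOrthonormalFrame g G x)
    (hX : SmoothNear X x) (hY : SmoothNear Y x) (hZ : SmoothNear Z x) :
    covDeriv (leviCivita g) (covDeriv (leviCivita g) (czebyshev g D)) ![X, Y, Z] x =
      ∑ i, covDeriv (leviCivita g) (covDeriv (leviCivita g) (cubicForm g D))
        ![X, Y, Z, G i, G i] x := by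
  have hLC := preservesSmooth_leviCivita g
  have hA := (isTensorOn_cubicForm (g := g) hD).covDeriv g isOpen_univ hLC
  have hB' : IsTensorOn (fun W ↦ covDeriv (leviCivita g) (cubicForm g D) (Fin.cons Y W))
      {y | SmoothNear Y y} := hA.insert (fun _ h ↦ h) (Set.subset_univ _)
  have hB : IsTensorOn
      (fun W ↦ covDeriv (leviCivita g) (cubicForm g D) (Fin.cons Y (Fin.cons Z W)))
      ({y | SmoothNear Y y} ∩ {y | SmoothNear Z y}) :=
    hB'.insert (fun _ h ↦ h.2) Set.inter_subset_left
  rw [covDeriv_two, mvfderiv_congr (f' := fun y ↦ ∑ i, covDeriv (leviCivita g) (cubicForm g D)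
    ![Y, Z, G i, G i] y), covDeriv_czebyshev hD hG (hLC hX hY) hZ,
    covDeriv_czebyshev hD hG hY (hLC hX hZ), sub_eq_iff_eq_add, ← Finset.sum_add_distrib,
    ← Finset.sum_add_distrib]
  · refine (mvfderiv_trace hB ⟨hY, hZ⟩ hG hX).trans (Finset.sum_congr rfl fun i _ ↦ ?_)
    have e1 := covDeriv_insert (x := x) (leviCivita g)
      (fun W ↦ covDeriv (leviCivita g) (cubicForm g D) (Fin.cons Y W)) Z X ![G i, G i]
    have e2 := covDeriv_insert (x := x) (leviCivita g)
      (covDeriv (leviCivita g) (cubicForm g D)) Y X ![Z, G i, G i]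
    exact e1.trans ((congrArg (· + _) e2).trans (add_assoc _ _ _))
  · filter_upwards [hG.eventually, hY.eventually, hZ.eventually] with y h1 h2 h3
    exact covDeriv_czebyshev hD h1 h2 h3

section

variable {α : Type*}

lemma vec₃_eta (f : Fin 3 → α) : f = ![f 0, f 1, f 2] := by
  ext1 a
  fin_cases a <;> rfl

lemma vec₃_comp_swap₀₁ (f : Fin 3 → α) :
    f ∘ Equiv.swap 0 1 = ![f 1, f 0, f 2] := by
  ext1 a
  fin_cases a <;> rfl

lemma vec₃_comp_swap₁₂ (f : Fin 3 → α) :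
    f ∘ Equiv.swap 1 2 = ![f 0, f 2, f 1] := by
  ext1 a
  fin_cases a <;> rfl

lemma vec₄_eta (f : Fin 4 → α) : f = ![f 0, f 1, f 2, f 3] := by
  ext1 a
  fin_cases a <;> rfl

lemma vec₄_comp_swap₀₁ (f : Fin 4 → α) :
    f ∘ Equiv.swap 0 1 = ![f 1, f 0, f 2, f 3] := by
  ext1 a
  fin_cases a <;> rfl

lemma vec₄_comp_swap₁₂ (f : Fin 4 → α) :
    f ∘ Equiv.swap 1 2 = ![f 0, f 2, f 1, f 3] := by
  ext1 a
  fin_cases a <;> rfl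

lemma vec₄_comp_swap₂₃ (f : Fin 4 → α) :
    f ∘ Equiv.swap 2 3 = ![f 0, f 1, f 3, f 2] := by
  ext1 a
  fin_cases a <;> rfl

end

/-- The commutation formula for the rough Laplacian of the cubic form. -/
lemma laplacian_cubicForm (h : IsStatistical g D) (hconj : IsConjugateSymmetric g D)
    (hD : PreservesSmooth D) (hX : SmoothNear X x) (hY : SmoothNear Y x) (hZ : SmoothNear Z x) :
    laplacian g (cubicForm g D) ![X, Y, Z] x =
      covDeriv (leviCivita g) (covDeriv (leviCivita g) (czebyshev g D)) ![X, Y, Z] x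
      - ∑ l, (g.inner x (diffHom g D x (Y x) (curvature (leviCivita g) (extend E (onb g x l)) X
            (extend E (onb g x l)) x)) (Z x)
        + g.inner x (diffHom g D x (curvature (leviCivita g) (extend E (onb g x l)) X Y x)
            (onb g x l)) (Z x)
        + g.inner x (diffHom g D x (Y x) (onb g x l))
            (curvature (leviCivita g) (extend E (onb g x l)) X Z x)) := by
  have hLC := preservesSmooth_leviCivita g
  -- The frame agrees with `onb g x` at x, so the two traces can be compared term by term.
  obtain ⟨G, hG, hGe⟩ := exists_orthonormalFrame_eq_onb g x
  have hA2 := ((isTensorOn_cubicForm (g := g) hD).covDeriv g isOpen_univ hLC).covDeriv g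
    isOpen_univ hLC
  have a01 (y : M) (X : Fin 3 → Π x : M, TangentSpace I x) (hX : ∀ a, SmoothNear (X a) y) :
      cubicForm g D (X ∘ Equiv.swap 0 1) y = cubicForm g D X y := by
    rw [vec₃_comp_swap₀₁, cubicForm_swap₁₂ h (hX 1) (hX 0), ← vec₃_eta]
  have a12 (y : M) (X : Fin 3 → Π x : M, TangentSpace I x) (hX : ∀ a, SmoothNear (X a) y) :
      cubicForm g D (X ∘ Equiv.swap 1 2) y = cubicForm g D X y := by
    rw [vec₃_comp_swap₁₂, cubicForm_swap₂₃ h (hX 2) (hX 1), ← vec₃_eta]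
  have s01 (y : M) (X : Fin 4 → Π x : M, TangentSpace I x) (hX : ∀ a, SmoothNear (X a) y) :
      covDeriv (leviCivita g) (cubicForm g D) (X ∘ Equiv.swap 0 1) y =
      covDeriv (leviCivita g) (cubicForm g D) X y := by
    rw [vec₄_comp_swap₀₁, codazzi h hconj hD (hX 1) (hX 0) (hX 2) (hX 3), ← vec₄_eta]
  have s12 (y : M) (X : Fin 4 → Π x : M, TangentSpace I x) (hX : ∀ a, SmoothNear (X a) y) :
      covDeriv (leviCivita g) (cubicForm g D) (X ∘ Equiv.swap 1 2) y =
      covDeriv (leviCivita g) (cubicForm g D) X y := by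
    have := covDeriv_comp_perm hLC _ a01 (hX 0) ((hX 1).vec₃ (hX 2) (hX 3))
    rw [vec₃_comp_swap₀₁] at this
    rw [vec₄_comp_swap₁₂]
    exact this.trans (by rw [← Matrix.vecCons, ← vec₄_eta])
  have s23 (y : M) (X : Fin 4 → Π x : M, TangentSpace I x) (hX : ∀ a, SmoothNear (X a) y) :
      covDeriv (leviCivita g) (cubicForm g D) (X ∘ Equiv.swap 2 3) y =
      covDeriv (leviCivita g) (cubicForm g D) X y := by
    have := covDeriv_comp_perm hLC _ a12 (hX 0) ((hX 1).vec₃ (hX 2) (hX 3))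
    rw [vec₃_comp_swap₁₂] at this
    rw [vec₄_comp_swap₂₃]
    exact this.trans (by rw [← Matrix.vecCons, ← vec₄_eta])
  -- Total symmetry of ∇̂A passes to the last four slots of ∇̂²A.
  have t01 {X Y Z W V} (hX : SmoothNear X x) (hY : SmoothNear Y x) (hZ : SmoothNear Z x)
      (hW : SmoothNear W x) (hV : SmoothNear V x) :
      covDeriv (leviCivita g) (covDeriv (leviCivita g) (cubicForm g D)) ![X, Y, Z, W, V] x =
      covDeriv (leviCivita g) (covDeriv (leviCivita g) (cubicForm g D)) ![X, Z, Y, W, V] x := by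
    have := covDeriv_comp_perm hLC _ s01 hX (hZ.vec₄ hY hW hV)
    rwa [vec₄_comp_swap₀₁] at this
  have t12 {X Y Z W V} (hX : SmoothNear X x) (hY : SmoothNear Y x) (hZ : SmoothNear Z x)
      (hW : SmoothNear W x) (hV : SmoothNear V x) :
      covDeriv (leviCivita g) (covDeriv (leviCivita g) (cubicForm g D)) ![X, Y, Z, W, V] x =
      covDeriv (leviCivita g) (covDeriv (leviCivita g) (cubicForm g D)) ![X, Y, W, Z, V] x := by
    have := covDeriv_comp_perm hLC _ s12 hX (hY.vec₄ hW hZ hV)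
    rwa [vec₄_comp_swap₁₂] at this
  have t23 {X Y Z W V} (hX : SmoothNear X x) (hY : SmoothNear Y x) (hZ : SmoothNear Z x)
      (hW : SmoothNear W x) (hV : SmoothNear V x) :
      covDeriv (leviCivita g) (covDeriv (leviCivita g) (cubicForm g D)) ![X, Y, Z, W, V] x =
      covDeriv (leviCivita g) (covDeriv (leviCivita g) (cubicForm g D)) ![X, Y, Z, V, W] x := by
    have := covDeriv_comp_perm hLC _ s23 hX (hY.vec₄ hZ hV hW)
    rwa [vec₄_comp_swap₂₃] at this
  rw [covDeriv_covDeriv_czebyshev hD hG hX hY hZ, ← Finset.sum_sub_distrib]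
  refine Finset.sum_congr rfl fun l _ ↦ ?_
  have hF : SmoothNear (extend E (onb g x l)) x := smoothNear_extend _
  have hGF : covDeriv (leviCivita g) (covDeriv (leviCivita g) (cubicForm g D))
      ![X, Y, Z, G l, G l] x = covDeriv (leviCivita g) (covDeriv (leviCivita g) (cubicForm g D))
      ![X, Y, Z, extend E (onb g x l), extend E (onb g x l)] x := by
    refine hA2.eq_of_eq trivial (hX.finCons (hY.vec₄ hZ (hG.smooth l) (hG.smooth l)))
      (hX.finCons (hY.vec₄ hZ hF hF)) fun a ↦ ?_
    match a with
    | 0 | 1 | 2 => rfl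
    | 3 | 4 => exact (hGe l).trans (extend_apply_self E (onb g x l)).symm
  -- The slots move as (e, e, X, Y, Z) → (e, X, e, Y, Z) → (X, e, e, Y, Z) → (X, Y, Z, e, e); only
  -- the second move, by the Ricci identity, produces curvature.
  refine (t01 hF hF hX hY hZ).trans ?_
  rw [ricci_identity hD hF hX hF hY hZ, hGF, t01 hX hF hF hY hZ, t12 hX hF hF hY hZ,
    t01 hX hF hY hF hZ, t23 hX hY hF hF hZ, t12 hX hY hF hZ hF]
  simp only [extend_apply_self]

end

/-! ### The Bochner-type formulas in an orthonormal basis -/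

section

variable {ι : Type*} [Fintype ι]

lemma sum_rotate₄ (f : ι → ι → ι → ι → ℝ) :
    ∑ i, ∑ j, ∑ k, ∑ l, f i j k l = ∑ l, ∑ i, ∑ j, ∑ k, f i j k l := by
  calc ∑ i, ∑ j, ∑ k, ∑ l, f i j k l = ∑ i, ∑ j, ∑ l, ∑ k, f i j k l :=
        Finset.sum_congr rfl fun i _ ↦ Finset.sum_congr rfl fun j _ ↦ Finset.sum_comm
    _ = ∑ i, ∑ l, ∑ j, ∑ k, f i j k l := Finset.sum_congr rfl fun i _ ↦ Finset.sum_comm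
    _ = _ := Finset.sum_comm

/-- The contraction with `a` of the curvature terms in the Laplacian of a cubic form `a`. -/
lemma sum_curvature_mul_cubic {a : ι → ι → ι → ℝ} {r : ι → ι → ι → ι → ℝ}
    (ha : ∀ i j k, a i j k = a i k j) (hr : ∀ l i j m, r l i j m = -r i l j m) (hr' : ∀ l i j m, r l i j m = -r l i m j) :
    ∑ i, ∑ j, ∑ k, (∑ l, ∑ m, (r l i l m * a m j k + r l i j m * a l m k + r l i k m * a l j m))
        * a i j k =
      ∑ l, ∑ i, ∑ k, ∑ m, (∑ j, (a l m j * a i k j - a i m j * a l k j)) * r l i k m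
      - ∑ i, ∑ m, (∑ l, r l i m l) * ∑ j, ∑ k, a i j k * a m j k := by
  -- The curvature acting on the traced slot gives the Ricci term; its sign comes from skewness in
  -- the last pair.
  have h1 : ∑ i, ∑ j, ∑ k, ∑ l, ∑ m, r l i l m * a m j k * a i j k =
      -∑ i, ∑ m, (∑ l, r l i m l) * ∑ j, ∑ k, a i j k * a m j k := by
    rw [← Finset.sum_neg_distrib]
    refine Finset.sum_congr rfl fun i _ ↦ ?_
    rw [sum_rotate₄, ← Finset.sum_neg_distrib]
    refine Finset.sum_congr rfl fun m _ ↦ ?_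
    calc ∑ j, ∑ k, ∑ l, r l i l m * a m j k * a i j k
        = ∑ j, ∑ k, -((∑ l, r l i m l) * (a i j k * a m j k)) := by
          refine Finset.sum_congr rfl fun j _ ↦ Finset.sum_congr rfl fun k _ ↦ ?_
          rw [Finset.sum_mul, ← Finset.sum_neg_distrib]
          refine Finset.sum_congr rfl fun l _ ↦ ?_
          rw [hr' l i l m]
          ring
      _ = _ := by simp only [Finset.sum_neg_distrib, Finset.mul_sum]
  have h2 : ∑ i, ∑ j, ∑ k, ∑ l, ∑ m, r l i j m * a l m k * a i j k =
      ∑ l, ∑ i, ∑ k, ∑ m, (∑ j, a l m j * a i k j) * r l i k m := by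
    rw [sum_rotate₄]
    refine Finset.sum_congr rfl fun l _ ↦ Finset.sum_congr rfl fun i _ ↦
      Finset.sum_congr rfl fun k _ ↦ Finset.sum_comm.trans (Finset.sum_congr rfl fun m _ ↦ ?_)
    rw [Finset.sum_mul]
    exact Finset.sum_congr rfl fun j _ ↦ by ring
  -- By symmetry of a in its last two indices the third term equals the second. By `h4`, skewness of
  -- r in its first pair, the [K, K] contraction is twice this common value.
  have h3 : ∑ i, ∑ j, ∑ k, ∑ l, ∑ m, r l i k m * a l j m * a i j k =
      ∑ l, ∑ i, ∑ k, ∑ m, (∑ j, a l m j * a i k j) * r l i k m := by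
    rw [← h2]
    refine Finset.sum_congr rfl fun i _ ↦ Finset.sum_comm.trans <|
      Finset.sum_congr rfl fun k _ ↦ Finset.sum_congr rfl fun j _ ↦
      Finset.sum_congr rfl fun l _ ↦ Finset.sum_congr rfl fun m _ ↦ ?_
    rw [ha l j m, ha i j k]
  have h4 : ∑ l, ∑ i, ∑ k, ∑ m, (∑ j, a i m j * a l k j) * r l i k m =
      -∑ l, ∑ i, ∑ k, ∑ m, (∑ j, a l m j * a i k j) * r l i k m := by
    rw [Finset.sum_comm]
    simp only [← Finset.sum_neg_distrib]
    refine Finset.sum_congr rfl fun i _ ↦ Finset.sum_congr rfl fun l _ ↦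
      Finset.sum_congr rfl fun k _ ↦ Finset.sum_congr rfl fun m _ ↦ ?_
    rw [hr l i k m]
    ring
  have h5 : ∑ l, ∑ i, ∑ k, ∑ m, (∑ j, (a l m j * a i k j - a i m j * a l k j)) * r l i k m =
      ∑ l, ∑ i, ∑ k, ∑ m, (∑ j, a l m j * a i k j) * r l i k m -
      ∑ l, ∑ i, ∑ k, ∑ m, (∑ j, a i m j * a l k j) * r l i k m := by
    simp only [Finset.sum_sub_distrib, sub_mul]
  simp only [Finset.sum_mul, add_mul, Finset.sum_add_distrib]
  simp only [Finset.sum_mul] at h1 h2 h3 h4 h5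
  linarith

end

section

variable {g : SmoothMetric I M} {D : Connection I M}

lemma extend_cons (g : SmoothMetric I M) (x : M) {k : ℕ} (j : Fin (Module.finrank ℝ E))
    (i : Fin k → Fin (Module.finrank ℝ E)) :
    (fun a ↦ extend E (onb g x ((Fin.cons j i : Fin (k + 1) → Fin (Module.finrank ℝ E)) a)) :
        Fin (k + 1) → Π x : M, TangentSpace I x) =
      Matrix.vecCons (extend E (onb g x j)) fun a ↦ extend E (onb g x (i a)) := by
  funext a
  induction a using Fin.cases <;> rfl

lemma tensorInner_two (S T : TensorField I M 2) :
    tensorInner g S T x = ∑ i, ∑ j, S ![extend E (onb g x i), extend E (onb g x j)] x *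
      T ![extend E (onb g x i), extend E (onb g x j)] x := by
  simp only [tensorInner, TensorField.val, sum_finCons, extend_cons, Fintype.sum_unique]
  simp only [Matrix.empty_eq]

lemma tensorInner_three (S T : TensorField I M 3) :
    tensorInner g S T x = ∑ i, ∑ j, ∑ k,
      S ![extend E (onb g x i), extend E (onb g x j), extend E (onb g x k)] x *
      T ![extend E (onb g x i), extend E (onb g x j), extend E (onb g x k)] x := by
  simp only [tensorInner, TensorField.val, sum_finCons, extend_cons, Fintype.sum_unique]
  simp only [Matrix.empty_eq]

lemma tensorInner_four (S T : TensorField I M 4) :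
    tensorInner g S T x = ∑ i, ∑ j, ∑ k, ∑ l,
      S ![extend E (onb g x i), extend E (onb g x j), extend E (onb g x k),
        extend E (onb g x l)] x *
      T ![extend E (onb g x i), extend E (onb g x j), extend E (onb g x k),
        extend E (onb g x l)] x := by
  simp only [tensorInner, TensorField.val, sum_finCons, extend_cons, Fintype.sum_unique]
  simp only [Matrix.empty_eq]

/-- In components with respect to `onb g x` this is `sum_curvature_mul_cubic`; the signs are
reversed because `laplacian_cubicForm` subtracts the curvature terms. -/
lemma tensorInner_laplacian_cubicForm (h : IsStatistical g D) (hconj : IsConjugateSymmetric g D)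
    (hD : PreservesSmooth D) :
    tensorInner g (laplacian g (cubicForm g D)) (cubicForm g D) x =
      tensorInner g (covDeriv (leviCivita g) (covDeriv (leviCivita g) (czebyshev g D)))
        (cubicForm g D) x
      - tensorInner g (lower g (bracketKK g D)) (riem g (leviCivita g)) x
      + tensorInner g (ricci g (leviCivita g)) (innerKK g D) x := by
  set F : Fin (Module.finrank ℝ E) → Π x : M, TangentSpace I x := fun i ↦ extend E (onb g x i)
    with hFdef
  have hF (i) : SmoothNear (F i) x := smoothNear_extend _
  have hFe (i) : F i x = onb g x i := extend_apply_self E _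
  have he := isOrthonormalAt_onb g x
  let a (i j k : Fin (Module.finrank ℝ E)) : ℝ :=
    g.inner x (diffHom g D x (onb g x j) (onb g x i)) (onb g x k)
  let r (l i j m : Fin (Module.finrank ℝ E)) : ℝ :=
    g.inner x (curvature (leviCivita g) (F l) (F i) (F j) x) (onb g x m)
  have ha (i j k) : a i j k = a i k j := inner_diffHom_comm h _ _ _
  have hr (l i j m) : r l i j m = -r i l j m := by
    simp only [r]
    rw [curvature_swap (leviCivita g) (F i) (F l), map_neg, _root_.neg_apply]
  have hr' (l i j m) : r l i j m = -r l i m j := by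
    have := curvature_leviCivita_skew (g := g) (hF l) (hF i) (hF j) (hF m)
    rwa [hFe, hFe] at this
  have hA (i j k) : cubicForm g D ![F i, F j, F k] x = a i j k := by
    rw [cubicForm_apply (hF j), hFe, hFe, hFe]
  have expand (v w) : g.inner x v w = ∑ j, g.inner x v (onb g x j) * g.inner x w (onb g x j) := by
    rw [← he.sum_inner_mul]
    exact Finset.sum_congr rfl fun j _ ↦ by rw [g.symm x v, g.symm x w]
  have hlap (i j k) : laplacian g (cubicForm g D) ![F i, F j, F k] x =
      covDeriv (leviCivita g) (covDeriv (leviCivita g) (czebyshev g D)) ![F i, F j, F k] x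
      - ∑ l, ∑ m, (r l i l m * a m j k + r l i j m * a l m k + r l i k m * a l j m) := by
    rw [laplacian_cubicForm h hconj hD (hF i) (hF j) (hF k)]
    congr 1
    refine Finset.sum_congr rfl fun l _ ↦ ?_
    rw [Finset.sum_add_distrib, Finset.sum_add_distrib]
    simp only [hFe]
    congr 1
    · congr 1
      · conv_lhs => rw [← he.sum_smul (curvature (leviCivita g) (F l) (F i) (F l) x)]
        simp only [map_sum, map_smul, _root_.sum_apply, _root_.smul_apply, smul_eq_mul, r, a]
      · conv_lhs => rw [← he.sum_smul (curvature (leviCivita g) (F l) (F i) (F j) x)]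
        simp only [map_sum, map_smul, _root_.sum_apply, _root_.smul_apply, smul_eq_mul, r, a]
    · conv_lhs => rw [← he.sum_smul (curvature (leviCivita g) (F l) (F i) (F k) x)]
      simp only [map_sum, map_smul, smul_eq_mul, r, a]
  have hK (l i k m) : lower g (bracketKK g D) ![F l, F i, F k, F m] x =
      ∑ j, (a l m j * a i k j - a i m j * a l k j) := by
    refine (inner_bracketKK (W := F m) h hD (hF l) (hF i) (hF k)).trans ?_
    simp only [hFe]
    rw [expand (diffHom g D x (onb g x m) (onb g x l)),
      expand (diffHom g D x (onb g x m) (onb g x i)), ← Finset.sum_sub_distrib]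
  have hKK (i m) : innerKK g D ![F i, F m] x = ∑ j, ∑ k, a i j k * a m j k := by
    refine Finset.sum_congr rfl fun j _ ↦ ?_
    change g.inner x (diffTensor g D (F i) (F j) x) (diffTensor g D (F m) (F j) x) = _
    rw [diffTensor_apply (hF j), diffTensor_apply (hF j), hFe, hFe, hFe, expand]
  have hRic (i m) : ricci g (leviCivita g) ![F i, F m] x = ∑ l, r l i m l := rfl
  have hR (l i k m) : riem g (leviCivita g) ![F l, F i, F k, F m] x = r l i k m := by
    change g.inner x _ (F m x) = _
    rw [hFe]
    rfl
  have key := sum_curvature_mul_cubic ha hr hr'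
  rw [tensorInner_two, tensorInner_three, tensorInner_three, tensorInner_four]
  simp only [← hFdef] at *
  change (∑ i, ∑ j, ∑ k, laplacian g (cubicForm g D) ![F i, F j, F k] x *
      cubicForm g D ![F i, F j, F k] x) =
    (∑ i, ∑ j, ∑ k, covDeriv (leviCivita g) (covDeriv (leviCivita g) (czebyshev g D))
      ![F i, F j, F k] x * cubicForm g D ![F i, F j, F k] x)
    - (∑ l, ∑ i, ∑ k, ∑ m, lower g (bracketKK g D) ![F l, F i, F k, F m] x *
      riem g (leviCivita g) ![F l, F i, F k, F m] x)
    + ∑ i, ∑ m, ricci g (leviCivita g) ![F i, F m] x * innerKK g D ![F i, F m] x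
  simp only [hlap, hA, hK, hKK, hRic, hR, sub_mul, Finset.sum_sub_distrib] at key ⊢
  linarith

/-! ### The Gauss equation, its trace, and the three formulas. -/

/-- The Gauss equation `R = R̂ + [K, K]` of a conjugate symmetric statistical structure. -/
lemma gauss_equation (h : IsStatistical g D) (hconj : IsConjugateSymmetric g D)
    (hD : PreservesSmooth D) {X Y Z W : Π x : M, TangentSpace I x} (hX : SmoothNear X x)
    (hY : SmoothNear Y x) (hZ : SmoothNear Z x) (hW : SmoothNear W x) :
    g.inner x (curvature D X Y Z x) (W x) =
      g.inner x (curvature (leviCivita g) X Y Z x) (W x)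
      + g.inner x (bracketKK g D X Y Z x) (W x) := by
  rw [curvature_eq hD hX hY hZ hW, codazzi h hconj hD hX hY hZ hW, sub_self, add_zero]

/-- The contracted Gauss equation `Ric = Ric^ + τ ∘ K - g(K, K)`. -/
lemma ricci_eq (h : IsStatistical g D) (hconj : IsConjugateSymmetric g D)
    (hD : PreservesSmooth D) {Y Z : Π x : M, TangentSpace I x}
    (hY : SmoothNear Y x) (hZ : SmoothNear Z x) :
    ricci g D ![Y, Z] x =
      ricci g (leviCivita g) ![Y, Z] x + czebyshevDiff g D ![Y, Z] x - innerKK g D ![Y, Z] x := by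
  simp only [ricci, czebyshevDiff, innerKK, czebyshev, ← Finset.sum_add_distrib,
    ← Finset.sum_sub_distrib]
  refine Finset.sum_congr rfl fun l _ ↦ ?_
  change g.inner x (curvature D (extend E (onb g x l)) Y Z x) (onb g x l) =
    g.inner x (curvature (leviCivita g) (extend E (onb g x l)) Y Z x) (onb g x l)
    + cubicForm g D ![diffTensor g D Y Z, extend E (onb g x l), extend E (onb g x l)] x
    - g.inner x (diffTensor g D Y (extend E (onb g x l)) x)
      (diffTensor g D Z (extend E (onb g x l)) x)
  have hF : SmoothNear (extend E (onb g x l)) x := smoothNear_extend _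
  -- With W equal to the traced vector e, the two halves of [K, K] are g(K(e, e), K(Y, Z)), whose
  -- sum is τ(K(Y, Z)), and g(K(Y, e), K(e, Z)), whose sum is g(K_Y, K_Z).
  have := gauss_equation h hconj hD hF hY hZ hF
  rw [inner_bracketKK h hD hF hY hZ] at this
  simp only [extend_apply_self] at this
  rw [this, cubicForm_apply hF, diffTensor_apply hF, diffTensor_apply hF, diffTensor_apply hZ]
  simp only [extend_apply_self]
  rw [diffHom_comm h.torsion_free (diffHom g D x (Z x) (Y x)) (onb g x l),
    inner_diffHom_comm h, diffHom_comm h.torsion_free (Z x) (onb g x l)]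
  ring

lemma tensorInner_riem (h : IsStatistical g D) (hconj : IsConjugateSymmetric g D)
    (hD : PreservesSmooth D) (T : TensorField I M 4) :
    tensorInner g (riem g D) T x =
      tensorInner g (riem g (leviCivita g)) T x + tensorInner g (lower g (bracketKK g D)) T x := by
  simp only [tensorInner, ← Finset.sum_add_distrib, ← add_mul]
  refine Finset.sum_congr rfl fun i _ ↦ ?_
  congr 1
  exact gauss_equation h hconj hD (smoothNear_extend _) (smoothNear_extend _)
    (smoothNear_extend _) (smoothNear_extend _)

lemma tensorInner_sub_left {k : ℕ} (S S' T : TensorField I M k) :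
    tensorInner g (S - S') T x = tensorInner g S T x - tensorInner g S' T x := by
  simp [tensorInner, TensorField.val, sub_mul]

lemma tensorInner_comm {k : ℕ} (S T : TensorField I M k) :
    tensorInner g S T x = tensorInner g T S x := by
  simp only [tensorInner, mul_comm]

lemma tensorInner_ricci (h : IsStatistical g D) (hconj : IsConjugateSymmetric g D)
    (hD : PreservesSmooth D) (T : TensorField I M 2) :
    tensorInner g (ricci g D) T x = tensorInner g (ricci g (leviCivita g)) T x
      + tensorInner g (czebyshevDiff g D) T x - tensorInner g (innerKK g D) T x := by
  simp only [tensorInner_two, ← Finset.sum_add_distrib, ← Finset.sum_sub_distrib, ← add_mul,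
    ← sub_mul]
  refine Finset.sum_congr rfl fun i _ ↦ Finset.sum_congr rfl fun j _ ↦ ?_
  rw [ricci_eq h hconj hD (smoothNear_extend _) (smoothNear_extend _)]

end

end StatGeom

end

open StatGeom

theorem theorem4p15 {n : ℕ} {M : Type*} [TopologicalSpace M] [T2Space M]
    [ChartedSpace (EuclideanSpace ℝ (Fin n)) M] [IsManifold (𝓡 n) ∞ M]
    (g : SmoothMetric (𝓡 n) M) (D : Connection (𝓡 n) M)
    (hstat : IsStatistical g D) (hconj : IsConjugateSymmetric g D) (x : M) :
    (1 / 2 * laplacianFun g (tensorNormSq g (cubicForm g D)) x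
        = tensorNormSq g (covDeriv (leviCivita g) (cubicForm g D)) x
          + tensorInner g (covDeriv (leviCivita g) (covDeriv (leviCivita g) (czebyshev g D)))
              (cubicForm g D) x
          - tensorInner g (lower g (bracketKK g D)) (riem g (leviCivita g)) x
          + tensorInner g (ricci g (leviCivita g)) (innerKK g D) x) ∧
    (1 / 2 * laplacianFun g (tensorNormSq g (cubicForm g D)) x
        = tensorNormSq g (covDeriv (leviCivita g) (cubicForm g D)) x
          + tensorInner g (covDeriv (leviCivita g) (covDeriv (leviCivita g) (czebyshev g D)))
              (cubicForm g D) x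
          + tensorInner g (riem g (leviCivita g) - riem g D) (riem g (leviCivita g)) x
          + tensorInner g (ricci g (leviCivita g)) (innerKK g D) x) ∧
    (1 / 2 * laplacianFun g (tensorNormSq g (cubicForm g D)) x
        = tensorNormSq g (covDeriv (leviCivita g) (cubicForm g D)) x
          + tensorInner g (covDeriv (leviCivita g) (covDeriv (leviCivita g) (czebyshev g D)))
              (cubicForm g D) x
          + tensorNormSq g (riem g (leviCivita g)) x
          + tensorNormSq g (ricci g (leviCivita g)) x
          - tensorInner g (riem g D) (riem g (leviCivita g)) x
          - tensorInner g (ricci g D) (ricci g (leviCivita g)) x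
          + tensorInner g (ricci g (leviCivita g)) (czebyshevDiff g D) x) := by
  have hD := preservesSmooth_of_contMDiff hstat.smooth
  have h1 := laplacianFun_tensorNormSq (g := g) (x := x) (isTensorOn_cubicForm (g := g) hD)
  have h2 := tensorInner_laplacian_cubicForm hstat hconj hD (x := x)
  have h3 := tensorInner_riem hstat hconj hD (riem g (leviCivita g)) (x := x)
  have h4 := tensorInner_ricci hstat hconj hD (ricci g (leviCivita g)) (x := x)
  have h5 := tensorInner_comm (ricci g (leviCivita g)) (innerKK g D) (x := x) (g := g)
  have h6 := tensorInner_comm (ricci g (leviCivita g)) (czebyshevDiff g D) (x := x) (g := g)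
  rw [tensorInner_sub_left, tensorNormSq.eq_1 g (riem g (leviCivita g)),
    tensorNormSq.eq_1 g (ricci g (leviCivita g))]
  -- `h1` and `h2` give the first formula; `h3` replaces -g([K, K], R̂) by g(R̂ - R, R̂), and `h4`
  -- expresses g(Ric^, g(K, K)) through Ric and τ ∘ K.
  exact ⟨by linarith, by linarith, by linarith⟩
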